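/- Let $\Omega=(0,2\pi)^2$, let $\dot L^2$ be the space of real square integrable functions on $\Omega$ with mean zero, with norm $\|\cdot\|_2$, and for mean-zero $2\pi$-periodic $\varphi$ put $\|\varphi\|_{H^1}=\|\nabla\varphi\|_2$. Let $c_0>0$ be a constant in the Poincaré inequality $\|\varphi\|_2\le c_0\|\varphi\|_{H^1}$ for such $\varphi$. For $K\in\mathbb N$ let $\mathcal P_K$ be the space of real mean-zero trigonometric polynomials on $\Omega$ with frequency at most $K$ in each direction, and $P_K$ the $L^2$-orthogonal projection onto $\mathcal P_K$. Given $\nu>0$, $\Delta t>0$, $\omega_0\in\dot L^2$ and forcing terms $f^n\in\dot L^2$ with $\|f^n\|_2\le\|f\|_\infty$ for all $n\ge 0$ (for example $f^n=f(n\Delta t)$ with $\|f\|_\infty=\sup_{t\ge0}\|f(t)\|_2<\infty$), let $\omega_K^n,\psi_K^n\in\mathcal P_K$ solve the Galerkin Fourier spectral scheme $$\frac{\omega_K^{n+1}-\omega_K^n}{\Delta t}+P_K(\nabla^\perp\psi_K^n\cdot\nabla\omega_K^n)-\nu\Delta\omega_K^{n+1}=P_K f^n,\qquad -\Delta\psi_K^n=\omega_K^n,\qquad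 \omega_K^0=P_K\omega_0,$$ where $\nabla^\perp\psi=(-\partial_y\psi,\partial_x\psi)$. There are an absolute constant $C_w\ge1$ and positive numbers $M_0=M_0(\|\omega_0\|_2,\nu,\|f\|_\infty)$ such that, for every $K$, if $0<\Delta t\le \nu/(4C_w^2M_0^2)$, then $$\|\omega_K^n\|_2\le M_0\qquad\text{for all }n\ge0,$$ $$\|\omega_K^n\|_2^2\le\Bigl(1+\frac{\nu}{2c_0^2}\Delta t\Bigr)^{-n}\|\omega_0\|_2^2+\frac{2c_0^4}{\nu^2}\|f\|_\infty^2\Bigl[1-\Bigl(1+\frac{\nu}{2c_0^2}\Delta t\Bigr)^{-n}\Bigr]\qquad\text{for all }n\ge0,$$ $$\frac{\nu}{2}\Delta t\sum_{n=i}^m\|\omega_K^n\|_{H^1}^2\le\|\omega_K^{i-1}\|_2^2+\frac{c_0^2}{\nu}\|f\|_\infty^2(m-i+1)\Delta t\qquad\text{for all }2\le i\le m.$$ Moreover, there are numbers $M_1=M_1(\nu,\|f\|_\infty)$ and $T=T(\|\omega_0\|_2,\nu,\|f\|_\infty)$ such that, for every $K$, if $0<\Delta t\le\min\{\nu/(4C_w^2M_0^2),\,2c_0^2/\nu\}$,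 then $$\|\omega_K^n\|_{H^1}\le M_1\qquad\text{for all } n \text{ with } n\Delta t\ge T,$$ that is, for all $n\ge N:=\lceil T/\Delta t\rceil$. The numbers $M_0$, $M_1$ and $T$ may depend on the fixed constant $c_0$, but not on the truncation $K$, nor on $\Delta t$. -/

import Mathlib

open MeasureTheory

noncomputable section

namespace GalerkinNSE

/-- The periodic cell `Ω = (0, 2π) × (0, 2π)`. -/
def cell : Set (ℝ × ℝ) := Set.Ioo 0 (2 * Real.pi) ×ˢ Set.Ioo 0 (2 * Real.pi)

/-- Real square integrable functions on `Ω` with mean zero. -/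
def DotL2 (g : ℝ × ℝ → ℝ) : Prop :=
  MemLp g 2 (volume.restrict cell) ∧ ∫ x in cell, g x = 0

/-- Partial derivative in the first variable. -/
def dx (φ : ℝ × ℝ → ℝ) (p : ℝ × ℝ) : ℝ := deriv (fun t => φ (t, p.2)) p.1

/-- Partial derivative in the second variable. -/
def dy (φ : ℝ × ℝ → ℝ) (p : ℝ × ℝ) : ℝ := deriv (fun t => φ (p.1, t)) p.2

/-- The Laplacian. -/
def lap (φ : ℝ × ℝ → ℝ) (p : ℝ × ℝ) : ℝ := dx (dx φ) p + dy (dy φ) p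

/-- The advection term `∇^⊥ψ · ∇ω`, with `∇^⊥ψ = (-∂_y ψ, ∂_x ψ)`. -/
def advect (ψ ω : ℝ × ℝ → ℝ) (p : ℝ × ℝ) : ℝ := -dy ψ p * dx ω p + dx ψ p * dy ω p

/-- The norm of `L²(Ω)`. -/
def l2norm (φ : ℝ × ℝ → ℝ) : ℝ := Real.sqrt (∫ x in cell, φ x ^ 2)

/-- The norm `‖∇φ‖_{L²}` of mean-zero periodic functions in `H¹`. -/
def h1norm (φ : ℝ × ℝ → ℝ) : ℝ := Real.sqrt (∫ x in cell, (dx φ x ^ 2 + dy φ x ^ 2))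

/-- The real mean-zero trigonometric polynomials with frequency at most `N` in each
direction. -/
def trigPoly (N : ℕ) : Submodule ℝ (ℝ × ℝ → ℝ) :=
  Submodule.span ℝ {g | ∃ k l : ℤ, |k| ≤ (N : ℤ) ∧ |l| ≤ (N : ℤ) ∧ (k ≠ 0 ∨ l ≠ 0) ∧
    (g = (fun x => Real.cos ((k : ℝ) * x.1 + (l : ℝ) * x.2)) ∨
     g = (fun x => Real.sin ((k : ℝ) * x.1 + (l : ℝ) * x.2)))}

/-- `p = P_N g`: `p` is the `L²(Ω)`-orthogonal projection of `g` onto `trigPoly N`. -/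
def IsProj (N : ℕ) (g p : ℝ × ℝ → ℝ) : Prop :=
  p ∈ trigPoly N ∧ ∀ φ ∈ trigPoly N, ∫ x in cell, (g x - p x) * φ x = 0

/-- `ω` (with stream functions `ψ`) is the sequence of iterates of the semi-implicit Fourier
Galerkin scheme with viscosity `ν`, time step `dt`, truncation `N`, initial vorticity `ω₀` and
forcing `f n` at step `n`:
`(ω^{n+1} - ω^n)/dt + P_N (∇^⊥ψ^n · ∇ω^n) - ν Δω^{n+1} = P_N f^n`, `-Δψ^n = ω^n`,
`ω^0 = P_N ω₀`. -/
structure IsGalerkinSolution (ν dt : ℝ) (N : ℕ) (ω₀ : ℝ × ℝ → ℝ) (f : ℕ → ℝ × ℝ → ℝ)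
    (ω ψ : ℕ → ℝ × ℝ → ℝ) : Prop where
  vorticity_mem : ∀ n, ω n ∈ trigPoly N
  stream_mem : ∀ n, ψ n ∈ trigPoly N
  stream_eq : ∀ n x, -lap (ψ n) x = ω n x
  init : IsProj N ω₀ (ω 0)
  step : ∀ n, ∃ q g : ℝ × ℝ → ℝ,
    IsProj N (advect (ψ n) (ω n)) q ∧ IsProj N (f n) g ∧
    ∀ x, (ω (n + 1) x - ω n x) / dt + q x - ν * lap (ω (n + 1)) x = g x

/-- `c₀` is a constant in the Poincaré inequality `‖φ‖_{L²} ≤ c₀ ‖∇φ‖_{L²}` for mean-zero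
periodic functions (tested on trigonometric polynomials, which are dense in `H¹`). -/
def IsPoincareConst (c₀ : ℝ) : Prop :=
  0 < c₀ ∧ ∀ N : ℕ, ∀ φ ∈ trigPoly N, l2norm φ ≤ c₀ * h1norm φ

end GalerkinNSE

end

noncomputable section

namespace GalerkinNSE

/-! Everything is done on Fourier coefficients, where `mass` is the squared `L²` norm and
`enstrophy` the squared `H¹` norm, both divided by `4π²`. The scheme becomes `(1 + ν dt |k|²) w_k =
v_k - dt (advection)_k + dt f_k`, and every estimate uses only the lattice sum `∑ |k|^(-5/2) ≤ Z`,
so nothing depends on the truncation. Only half-integer powers of `|k|` occur in the main weights,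
which is why `freqRt k = |k|^(1/2)` is the basic variable.

The nonlinearity is explicit, so testing with the new iterate `w` leaves `b(v, v, w) = b(v, v - w,
w)`. This is at most `velBound v * ‖v - w‖ * ‖∇w‖`, where `velBound` is the Wiener norm of the
velocity. If `dt * velBound v ^ 2 ≤ ν / 2`, the numerical dissipation `‖v - w‖²` and part of the
viscosity absorb it (`IsStep.mass_add_enstrophy_le`). In two dimensions `L²` does not control
`velBound` uniformly in the truncation. But one implicit step smooths: by `IsStep.velBound_le`, its
output has `velBound` of order `dt^(-1/4)` as `dt → 0`, so `dt * velBound ^ 2` tends to zero. Hence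
every step but the first is controlled by the mass two iterates back.

The first step starts from data merely in `L²` and is treated by frequency splitting
(`IsStep.mass_le_of_small`). Low output modes are tested against the equation, with the velocity
itself cut into low and high modes; high output modes are read off from the equation. The resulting
errors are absorbed by the dissipation.

For the `H¹` bound, testing with `-Δw` gives `y' ≤ y (1 + dt g y) + dt H` for the enstrophy, without
any restriction on the step. The dissipation over a time window of about unit length, once the
initial data have decayed, feeds the uniform Gronwall lemma.

The time step only has to be small in terms of `ν`, `‖ω₀‖`, `F`. Since `M₀` may be any function of
these, it is enlarged until the stated restriction on `dt` implies all the smallness needed, and `Cw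
= 1` serves. -/

/-- The squared Euclidean length of a frequency. -/
def freqSq (k : ℤ × ℤ) : ℝ := (k.1 : ℝ) ^ 2 + (k.2 : ℝ) ^ 2

/-- The square root of the Euclidean length of a frequency. -/
def freqRt (k : ℤ × ℤ) : ℝ := √(√(freqSq k))

lemma freqSq_nonneg (k : ℤ × ℤ) : 0 ≤ freqSq k := by unfold freqSq; positivity

lemma freqRt_sq (k : ℤ × ℤ) : freqRt k ^ 2 = √(freqSq k) := Real.sq_sqrt (Real.sqrt_nonneg _)

lemma freqRt_pow_four (k : ℤ × ℤ) : freqRt k ^ 4 = freqSq k := by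
  rw [show freqRt k ^ 4 = (freqRt k ^ 2) ^ 2 by ring, freqRt_sq, Real.sq_sqrt (freqSq_nonneg k)]

lemma one_le_freqSq {k : ℤ × ℤ} (hk : k ≠ 0) : 1 ≤ freqSq k := by
  have h : (1 : ℤ) ≤ k.1 ^ 2 + k.2 ^ 2 := by
    by_contra! h
    have h1 : k.1 ^ 2 = 0 := by nlinarith [sq_nonneg k.1, sq_nonneg k.2]
    have h2 : k.2 ^ 2 = 0 := by nlinarith [sq_nonneg k.1, sq_nonneg k.2]
    exact hk (Prod.ext (by simpa using h1) (by simpa using h2))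
  unfold freqSq
  exact_mod_cast h

lemma one_le_freqRt {k : ℤ × ℤ} (hk : k ≠ 0) : 1 ≤ freqRt k := by
  unfold freqRt
  rw [Real.one_le_sqrt, Real.one_le_sqrt]
  exact one_le_freqSq hk

lemma freqSq_neg (k : ℤ × ℤ) : freqSq (-k) = freqSq k := by simp [freqSq]

/-- The nonzero frequencies of size at most `N` in each direction. -/
def box (N : ℕ) : Finset (ℤ × ℤ) :=
  (Finset.Icc (-(N : ℤ)) N ×ˢ Finset.Icc (-(N : ℤ)) N).erase 0

lemma mem_box {N : ℕ} {k : ℤ × ℤ} : k ∈ box N ↔ k ≠ 0 ∧ |k.1| ≤ (N : ℤ) ∧ |k.2| ≤ (N : ℤ) := by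
  simp [box, abs_le]

lemma neg_mem_box {N : ℕ} {k : ℤ × ℤ} (hk : k ∈ box N) : -k ∈ box N := by
  rw [mem_box] at hk ⊢
  simpa using hk

/-- The summand is `|k|^(-5/2)`, and `5/2` exceeds the dimension. The sup norm is at most the
Euclidean one, so the sum is dominated by a convergent Eisenstein-type series. -/
lemma exists_sum_freqRt_le :
    ∃ Z : ℝ, 1 ≤ Z ∧ ∀ N : ℕ, ∑ k ∈ box N, 1 / freqRt k ^ 5 ≤ Z := by
  have hs := EisensteinSeries.summable_one_div_norm_rpow (k := 5 / 2) (by norm_num)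
  have hs' : Summable fun k : ℤ × ℤ => ‖(finTwoArrowEquiv ℤ).symm k‖ ^ (-(5 / 2) : ℝ) :=
    ((finTwoArrowEquiv ℤ).symm.summable_iff (f := fun x : Fin 2 → ℤ => ‖x‖ ^ (-(5 / 2) : ℝ))).2 hs
  refine ⟨max 1 (∑' k : ℤ × ℤ, ‖(finTwoArrowEquiv ℤ).symm k‖ ^ (-(5 / 2) : ℝ)),
    le_max_left _ _, fun N => le_max_of_le_right ?_⟩
  refine le_trans (Finset.sum_le_sum fun k hk => ?_)
    (hs'.sum_le_tsum (box N) fun k _ => by positivity)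
  have hk0 := (mem_box.1 hk).1
  have hle : ‖(finTwoArrowEquiv ℤ).symm k‖ ≤ √(freqSq k) := by
    refine (pi_norm_le_iff_of_nonneg (Real.sqrt_nonneg _)).2 fun i => ?_
    apply Real.le_sqrt_of_sq_le
    fin_cases i <;> simp [freqSq, Int.norm_eq_abs] <;> positivity
  have hpos : 0 < ‖(finTwoArrowEquiv ℤ).symm k‖ := by
    rw [norm_pos_iff]
    intro h
    apply hk0
    have h0 := congrFun h 0
    have h1 := congrFun h 1
    exact Prod.ext (by simpa using h0) (by simpa using h1)
  have h5 : 1 / freqRt k ^ 5 = √(freqSq k) ^ (-(5 / 2) : ℝ) := by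
    have h0 : 0 ≤ √(freqSq k) := Real.sqrt_nonneg _
    rw [freqRt, Real.rpow_neg h0, one_div, Real.sqrt_eq_rpow (√(freqSq k)), ← Real.rpow_natCast,
      ← Real.rpow_mul h0]
    norm_num
  rw [h5]
  exact Real.rpow_le_rpow_of_nonpos hpos hle (by norm_num)

/-! ### Norms of coefficient sequences and the trilinear form. -/

/-- `∑ |c_k|²`. -/
def mass (B : Finset (ℤ × ℤ)) (c : ℤ × ℤ → ℂ) : ℝ := ∑ k ∈ B, ‖c k‖ ^ 2

/-- `∑ |k|² |c_k|²`. -/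
def enstrophy (B : Finset (ℤ × ℤ)) (c : ℤ × ℤ → ℂ) : ℝ := ∑ k ∈ B, freqSq k * ‖c k‖ ^ 2

/-- `∑ |c_k| / |k|`, which controls the sup norm of the velocity with vorticity `c`. -/
def velBound (B : Finset (ℤ × ℤ)) (c : ℤ × ℤ → ℂ) : ℝ := ∑ k ∈ B, ‖c k‖ / freqRt k ^ 2

/-- The Fourier coefficients of the advection of `d` by the velocity with vorticity `p`. -/
def advCoeff (B : Finset (ℤ × ℤ)) (p d : ℤ × ℤ → ℂ) (k : ℤ × ℤ) : ℂ :=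
  ∑ j ∈ B, ((((j.2 : ℝ) * k.1 - j.1 * k.2) / freqSq j : ℝ) : ℂ) * p j * d (k - j)

lemma mass_nonneg (B : Finset (ℤ × ℤ)) (c : ℤ × ℤ → ℂ) : 0 ≤ mass B c :=
  Finset.sum_nonneg fun _ _ => by positivity

lemma enstrophy_nonneg (B : Finset (ℤ × ℤ)) (c : ℤ × ℤ → ℂ) : 0 ≤ enstrophy B c :=
  Finset.sum_nonneg fun k _ => mul_nonneg (freqSq_nonneg k) (by positivity)

lemma velBound_nonneg (B : Finset (ℤ × ℤ)) (c : ℤ × ℤ → ℂ) : 0 ≤ velBound B c :=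
  Finset.sum_nonneg fun _ _ => by positivity

lemma mass_le_enstrophy {B : Finset (ℤ × ℤ)} (hB : ∀ k ∈ B, k ≠ 0) (c : ℤ × ℤ → ℂ) :
    mass B c ≤ enstrophy B c :=
  Finset.sum_le_sum fun k hk =>
    le_mul_of_one_le_left (by positivity) (one_le_freqSq (hB k hk))

lemma sum_shift_le {B : Finset (ℤ × ℤ)} {h : ℤ × ℤ → ℝ} (h0 : ∀ k, 0 ≤ h k)
    (hoff : ∀ k, k ∉ B → h k = 0) (j : ℤ × ℤ) : ∑ k ∈ B, h (k - j) ≤ ∑ k ∈ B, h k := by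
  have hinj : Function.Injective fun k : ℤ × ℤ => k - j := sub_left_injective
  calc ∑ k ∈ B, h (k - j) = ∑ m ∈ B.map ⟨_, hinj⟩, h m := by rw [Finset.sum_map]; rfl
    _ ≤ ∑ m ∈ B.map ⟨_, hinj⟩ ∪ B, h m :=
        Finset.sum_le_sum_of_subset_of_nonneg Finset.subset_union_left fun k _ _ => h0 k
    _ = ∑ k ∈ B, h k := (Finset.sum_subset Finset.subset_union_right fun k _ hk => hoff k hk).symm

lemma sum_reflect_le {B : Finset (ℤ × ℤ)} {h : ℤ × ℤ → ℝ} (h0 : ∀ k, 0 ≤ h k)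
    (hoff : ∀ k, k ∉ B → h k = 0) (k : ℤ × ℤ) : ∑ j ∈ B, h (k - j) ≤ ∑ j ∈ B, h j := by
  have hinj : Function.Injective fun j : ℤ × ℤ => k - j := sub_right_injective
  calc ∑ j ∈ B, h (k - j) = ∑ m ∈ B.map ⟨_, hinj⟩, h m := by rw [Finset.sum_map]; rfl
    _ ≤ ∑ m ∈ B.map ⟨_, hinj⟩ ∪ B, h m :=
        Finset.sum_le_sum_of_subset_of_nonneg Finset.subset_union_left fun k _ _ => h0 k
    _ = ∑ j ∈ B, h j := (Finset.sum_subset Finset.subset_union_right fun k _ hk => hoff k hk).symm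

/-- Young's inequality `ℓ¹ * ℓ² → ℓ²` paired with `ℓ²`: Cauchy-Schwarz for each fixed `j`, then
summation against `x`. -/
lemma sum_conv_mul_le {B : Finset (ℤ × ℤ)} {x y z : ℤ × ℤ → ℝ} (hx : ∀ k ∈ B, 0 ≤ x k)
    (hoff : ∀ k, k ∉ B → y k = 0) :
    ∑ k ∈ B, (∑ j ∈ B, x j * y (k - j)) * z k ≤
      (∑ j ∈ B, x j) * (√(∑ k ∈ B, y k ^ 2) * √(∑ k ∈ B, z k ^ 2)) := by
  calc ∑ k ∈ B, (∑ j ∈ B, x j * y (k - j)) * z k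
      = ∑ j ∈ B, x j * ∑ k ∈ B, y (k - j) * z k := by
        simp_rw [Finset.sum_mul, Finset.mul_sum]
        rw [Finset.sum_comm]
        simp_rw [mul_assoc]
    _ ≤ ∑ j ∈ B, x j * (√(∑ k ∈ B, y k ^ 2) * √(∑ k ∈ B, z k ^ 2)) := by
        refine Finset.sum_le_sum fun j hj => mul_le_mul_of_nonneg_left ?_ (hx j hj)
        refine (Real.sum_mul_le_sqrt_mul_sqrt _ _ _).trans ?_
        refine mul_le_mul_of_nonneg_right (Real.sqrt_le_sqrt ?_) (Real.sqrt_nonneg _)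
        exact sum_shift_le (h := fun k => y k ^ 2) (fun k => sq_nonneg _)
          (fun k hk => by simp [hoff k hk]) j
    _ = _ := by rw [Finset.sum_mul]

/-- Lagrange's identity: `|j|² |k|²` is the square of the cross product plus the square of the inner
product. -/
lemma abs_cross_le (j k : ℤ × ℤ) :
    |(j.2 : ℝ) * k.1 - j.1 * k.2| ≤ freqRt j ^ 2 * freqRt k ^ 2 := by
  rw [freqRt_sq, freqRt_sq, ← Real.sqrt_mul (freqSq_nonneg j)]
  apply Real.abs_le_sqrt
  unfold freqSq
  nlinarith [sq_nonneg ((j.1 : ℝ) * k.1 + j.2 * k.2)]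

lemma abs_cross_div_le {j : ℤ × ℤ} (hj : j ≠ 0) (k : ℤ × ℤ) :
    |((j.2 : ℝ) * k.1 - j.1 * k.2) / freqSq j| ≤ freqRt k ^ 2 / freqRt j ^ 2 := by
  have hj1 := one_le_freqRt hj
  have hp : 0 < freqRt j := by linarith
  rw [abs_div, abs_of_nonneg (freqSq_nonneg j), ← freqRt_pow_four,
    div_le_div_iff₀ (by positivity) (by positivity)]
  have := abs_cross_le j k
  calc _ ≤ freqRt j ^ 2 * freqRt k ^ 2 * freqRt j ^ 2 :=
        mul_le_mul_of_nonneg_right this (by positivity)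
    _ = _ := by ring

/-- The divergence form: the derivative falls on the output frequency `k`, hence on the test
function once paired. -/
lemma norm_advCoeff_le {B : Finset (ℤ × ℤ)} (hB : ∀ k ∈ B, k ≠ 0) (p d : ℤ × ℤ → ℂ)
    (k : ℤ × ℤ) :
    ‖advCoeff B p d k‖ ≤ (∑ j ∈ B, ‖p j‖ / freqRt j ^ 2 * ‖d (k - j)‖) * freqRt k ^ 2 := by
  rw [Finset.sum_mul]
  refine (norm_sum_le _ _).trans (Finset.sum_le_sum fun j hj => ?_)
  rw [norm_mul, norm_mul, Complex.norm_real, Real.norm_eq_abs]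
  calc _ ≤ freqRt k ^ 2 / freqRt j ^ 2 * ‖p j‖ * ‖d (k - j)‖ := by
        gcongr
        exact abs_cross_div_le (hB j hj) k
    _ = _ := by ring

lemma norm_advCoeff_le_grad {B : Finset (ℤ × ℤ)} (hB : ∀ k ∈ B, k ≠ 0) (p d : ℤ × ℤ → ℂ)
    (k : ℤ × ℤ) :
    ‖advCoeff B p d k‖ ≤
      ∑ j ∈ B, ‖p j‖ / freqRt j ^ 2 * (freqRt (k - j) ^ 2 * ‖d (k - j)‖) := by
  refine (norm_sum_le _ _).trans (Finset.sum_le_sum fun j hj => ?_)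
  rw [norm_mul, norm_mul, Complex.norm_real, Real.norm_eq_abs]
  -- The cross product of `j` with itself vanishes, so the derivative can be moved to the advected
  -- factor.
  have h : (j.2 : ℝ) * k.1 - j.1 * k.2 = (j.2 : ℝ) * (k - j).1 - j.1 * (k - j).2 := by
    simp; ring
  rw [h]
  calc _ ≤ freqRt (k - j) ^ 2 / freqRt j ^ 2 * ‖p j‖ * ‖d (k - j)‖ := by
        gcongr
        exact abs_cross_div_le (hB j hj) _
    _ = _ := by ring

lemma norm_sum_advCoeff_mul_le {B : Finset (ℤ × ℤ)} (hB : ∀ k ∈ B, k ≠ 0)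
    (p : ℤ × ℤ → ℂ) {d : ℤ × ℤ → ℂ} (hd : ∀ k, k ∉ B → d k = 0) (w : ℤ × ℤ → ℂ) :
    ‖∑ k ∈ B, advCoeff B p d k * star (w k)‖ ≤
      velBound B p * (√(mass B d) * √(enstrophy B w)) := by
  have h := sum_conv_mul_le (B := B) (x := fun j => ‖p j‖ / freqRt j ^ 2)
    (y := fun k => ‖d k‖) (z := fun k => freqRt k ^ 2 * ‖w k‖)
    (fun k _ => by positivity) (fun k hk => by simp [hd k hk])
  have he : ∑ k ∈ B, (freqRt k ^ 2 * ‖w k‖) ^ 2 = enstrophy B w := by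
    refine Finset.sum_congr rfl fun k _ => ?_
    rw [← freqRt_pow_four]; ring
  rw [he] at h
  refine le_trans ((norm_sum_le _ _).trans (Finset.sum_le_sum fun k _ => ?_)) h
  rw [norm_mul, norm_star]
  calc _ ≤ _ := mul_le_mul_of_nonneg_right (norm_advCoeff_le hB p d k) (norm_nonneg _)
    _ = _ := by ring

lemma norm_sum_advCoeff_mul_le_grad {B : Finset (ℤ × ℤ)} (hB : ∀ k ∈ B, k ≠ 0)
    (p : ℤ × ℤ → ℂ) {d : ℤ × ℤ → ℂ} (hd : ∀ k, k ∉ B → d k = 0) (w : ℤ × ℤ → ℂ) :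
    ‖∑ k ∈ B, advCoeff B p d k * star (w k)‖ ≤
      velBound B p * (√(enstrophy B d) * √(mass B w)) := by
  have h := sum_conv_mul_le (B := B) (x := fun j => ‖p j‖ / freqRt j ^ 2)
    (y := fun k => freqRt k ^ 2 * ‖d k‖) (z := fun k => ‖w k‖)
    (fun k _ => by positivity) (fun k hk => by simp [hd k hk])
  have he : ∑ k ∈ B, (freqRt k ^ 2 * ‖d k‖) ^ 2 = enstrophy B d := by
    refine Finset.sum_congr rfl fun k _ => ?_
    rw [← freqRt_pow_four]; ring
  rw [he] at h
  refine le_trans ((norm_sum_le _ _).trans (Finset.sum_le_sum fun k _ => ?_)) h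
  rw [norm_mul, norm_star]
  exact mul_le_mul_of_nonneg_right (norm_advCoeff_le_grad hB p d k) (norm_nonneg _)

/-- The cancellation `b(p, w, w) = 0` holds separately for each velocity mode `j`, hence also for a
truncated velocity. Under `k ↦ j - k` the cross product changes sign, while the product of the two
factors of `w` is invariant because `w` is Hermitian. The box is not invariant under this map, but
the support of the summand is. -/
lemma sum_advCoeff_mul_self {B : Finset (ℤ × ℤ)} (hneg : ∀ k ∈ B, -k ∈ B)
    (p : ℤ × ℤ → ℂ) {w : ℤ × ℤ → ℂ} (hw : ∀ k, k ∉ B → w k = 0)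
    (hh : ∀ k, w (-k) = star (w k)) :
    ∑ k ∈ B, advCoeff B p w k * star (w k) = 0 := by
  simp_rw [advCoeff, Finset.sum_mul]
  rw [Finset.sum_comm]
  refine Finset.sum_eq_zero fun j _ => ?_
  set t : ℤ × ℤ → ℂ := fun k =>
    ((((j.2 : ℝ) * k.1 - j.1 * k.2) / freqSq j : ℝ) : ℂ) * p j * w (k - j) * star (w k) with ht
  have hsymm : ∀ k, t (j - k) = -t k := by
    intro k
    simp only [ht]
    rw [show j - k - j = -k by abel, hh, show j - k = -(k - j) by abel, hh, star_star,
      show (j.2 : ℝ) * (-(k - j)).1 - j.1 * (-(k - j)).2 = -((j.2 : ℝ) * k.1 - j.1 * k.2) by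
        simp; ring]
    push_cast
    ring
  have hmem : ∀ k, t k ≠ 0 → j - k ∈ B := by
    intro k hk
    have : k - j ∈ B := by
      by_contra hc
      exact hk (by simp [ht, hw _ hc])
    simpa using hneg _ this
  have h1 : ∑ k ∈ B, t k = ∑ k ∈ B, -t k := by
    refine Finset.sum_bij_ne_zero (fun k _ _ => j - k) (fun k _ hk => hmem k hk)
      (fun a _ _ b _ _ h => sub_right_injective h) (fun k _ hk => ?_) (fun k _ _ => ?_)
    · have hk' : t k ≠ 0 := neg_ne_zero.1 hk
      refine ⟨j - k, hmem k hk', ?_, by simp⟩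
      rw [hsymm]
      exact hk
    · rw [hsymm, neg_neg]
  rw [Finset.sum_neg_distrib] at h1
  exact self_eq_neg.1 h1

lemma norm_sum_mul_star_le (B : Finset (ℤ × ℤ)) (c d : ℤ × ℤ → ℂ) :
    ‖∑ k ∈ B, c k * star (d k)‖ ≤ √(mass B c) * √(mass B d) := by
  refine ((norm_sum_le _ _).trans_eq ?_).trans
    (Real.sum_mul_le_sqrt_mul_sqrt B (fun k => ‖c k‖) fun k => ‖d k‖)
  simp

/-- Cauchy-Schwarz with weight `|k|^(-2)` against `|k| |c_k|`; the sum of `|k|^(-4)` is below `Z`.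
-/
lemma velBound_le_enstrophy {B : Finset (ℤ × ℤ)} (hB : ∀ k ∈ B, k ≠ 0) {Z : ℝ}
    (hZ : ∑ k ∈ B, 1 / freqRt k ^ 5 ≤ Z) (c : ℤ × ℤ → ℂ) :
    velBound B c ^ 2 ≤ Z * enstrophy B c := by
  calc velBound B c ^ 2 = (∑ k ∈ B, 1 / freqRt k ^ 4 * (freqRt k ^ 2 * ‖c k‖)) ^ 2 := by
        congr 1
        refine Finset.sum_congr rfl fun k hk => ?_
        have : 0 < freqRt k := by linarith [one_le_freqRt (hB k hk)]
        field_simp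
    _ ≤ (∑ k ∈ B, (1 / freqRt k ^ 4) ^ 2) * ∑ k ∈ B, (freqRt k ^ 2 * ‖c k‖) ^ 2 :=
        Finset.sum_mul_sq_le_sq_mul_sq _ _ _
    _ ≤ Z * enstrophy B c := by
        refine mul_le_mul ((Finset.sum_le_sum fun k hk => ?_).trans hZ) (le_of_eq ?_)
          (Finset.sum_nonneg fun k _ => sq_nonneg _)
          ((Finset.sum_nonneg fun k _ => by unfold freqRt; positivity).trans hZ)
        · have h1 := one_le_freqRt (hB k hk)
          rw [div_pow, one_pow, ← pow_mul]
          exact one_div_le_one_div_of_le (by positivity) (pow_le_pow_right₀ h1 (by norm_num))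
        · exact Finset.sum_congr rfl fun k _ => by rw [← freqRt_pow_four]; ring

/-! ### Estimates for the quadratic flux from mass alone. -/

/-- The convolution bounding the Fourier coefficients of the flux. -/
def fluxConv (B : Finset (ℤ × ℤ)) (v : ℤ × ℤ → ℂ) (k : ℤ × ℤ) : ℝ :=
  ∑ j ∈ B, ‖v j‖ / freqRt j ^ 2 * ‖v (k - j)‖

/-- The convolution of the squared moduli of the Fourier coefficients. -/
def sqConv (B : Finset (ℤ × ℤ)) (v : ℤ × ℤ → ℂ) (k : ℤ × ℤ) : ℝ :=
  ∑ j ∈ B, (‖v j‖ * ‖v (k - j)‖) ^ 2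

lemma fluxConv_nonneg (B : Finset (ℤ × ℤ)) (v : ℤ × ℤ → ℂ) (k : ℤ × ℤ) : 0 ≤ fluxConv B v k :=
  Finset.sum_nonneg fun _ _ => by positivity

lemma sqConv_nonneg (B : Finset (ℤ × ℤ)) (v : ℤ × ℤ → ℂ) (k : ℤ × ℤ) : 0 ≤ sqConv B v k :=
  Finset.sum_nonneg fun _ _ => by positivity

lemma sum_norm_mul_norm_le {B : Finset (ℤ × ℤ)} {v : ℤ × ℤ → ℂ} (hv : ∀ k, k ∉ B → v k = 0)
    (k : ℤ × ℤ) : ∑ j ∈ B, ‖v j‖ * ‖v (k - j)‖ ≤ mass B v := by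
  refine (Real.sum_mul_le_sqrt_mul_sqrt B _ _).trans ?_
  have h : ∑ j ∈ B, ‖v (k - j)‖ ^ 2 ≤ mass B v :=
    sum_reflect_le (h := fun j => ‖v j‖ ^ 2) (fun _ => by positivity)
      (fun j hj => by simp [hv j hj]) k
  calc _ ≤ √(mass B v) * √(mass B v) :=
        mul_le_mul_of_nonneg_left (Real.sqrt_le_sqrt h) (Real.sqrt_nonneg _)
    _ = _ := Real.mul_self_sqrt (mass_nonneg B v)

lemma sum_sqConv_le {B : Finset (ℤ × ℤ)} {v : ℤ × ℤ → ℂ} (hv : ∀ k, k ∉ B → v k = 0) :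
    ∑ k ∈ B, sqConv B v k ≤ mass B v ^ 2 := by
  simp_rw [sqConv, mul_pow]
  rw [Finset.sum_comm]
  simp_rw [← Finset.mul_sum]
  rw [sq (mass B v)]
  nth_rewrite 1 [mass]
  rw [Finset.sum_mul]
  refine Finset.sum_le_sum fun j _ => mul_le_mul_of_nonneg_left ?_ (by positivity)
  exact sum_shift_le (h := fun j => ‖v j‖ ^ 2) (fun _ => by positivity)
      (fun j hj => by simp [hv j hj]) j

/-- Split at `|j| = |k|`. For `|j| ≤ |k|` one has `|j|^(-2) ≤ |k|^(1/2) |j|^(-5/2)`, and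
Cauchy-Schwarz produces `Z` and `sqConv` (the sum `P`). For `|j| ≥ |k|` the weight is at most
`1/|k|`, and the remaining convolution is at most the mass (the sum `Q`). -/
lemma fluxConv_sq_le {B : Finset (ℤ × ℤ)} (hB : ∀ k ∈ B, k ≠ 0) {Z : ℝ}
    (hZ : ∑ k ∈ B, 1 / freqRt k ^ 5 ≤ Z) {v : ℤ × ℤ → ℂ} (hv : ∀ k, k ∉ B → v k = 0)
    {k : ℤ × ℤ} (hk : k ≠ 0) :
    fluxConv B v k ^ 2 ≤ 2 * (freqRt k * Z * sqConv B v k) + 2 * (mass B v ^ 2 / freqRt k ^ 4) := by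
  have hk1 := one_le_freqRt hk
  have hk0 : 0 < freqRt k := by linarith
  set P := ∑ j ∈ B, √(freqRt k * (1 / freqRt j ^ 5)) * (‖v j‖ * ‖v (k - j)‖) with hP
  set Q := ∑ j ∈ B, 1 / freqRt k ^ 2 * (‖v j‖ * ‖v (k - j)‖) with hQ
  have hPQ : fluxConv B v k ≤ P + Q := by
    rw [hP, hQ, ← Finset.sum_add_distrib]
    refine Finset.sum_le_sum fun j hj => ?_
    have hj1 := one_le_freqRt (hB j hj)
    have hj0 : 0 < freqRt j := by linarith
    rw [← add_mul, div_mul_eq_mul_div, div_eq_mul_one_div, mul_comm _ (1 / freqRt j ^ 2)]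
    refine mul_le_mul_of_nonneg_right ?_ (by positivity)
    rcases le_total (freqRt j) (freqRt k) with h | h
    · have : 1 / freqRt j ^ 2 ≤ √(freqRt k * (1 / freqRt j ^ 5)) := by
        apply Real.le_sqrt_of_sq_le
        rw [mul_one_div, div_pow, one_pow, ← pow_mul, div_le_div_iff₀ (by positivity) (by positivity)]
        calc 1 * freqRt j ^ 5 = freqRt j * freqRt j ^ 4 := by ring
          _ ≤ _ := by gcongr
      have h2 : 0 ≤ 1 / freqRt k ^ 2 := by positivity
      linarith
    · have : 1 / freqRt j ^ 2 ≤ 1 / freqRt k ^ 2 :=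
        one_div_le_one_div_of_le (by positivity) (pow_le_pow_left₀ hk0.le h 2)
      have h2 := Real.sqrt_nonneg (freqRt k * (1 / freqRt j ^ 5))
      linarith
  have hP2 : P ^ 2 ≤ freqRt k * Z * sqConv B v k := by
    refine (Finset.sum_mul_sq_le_sq_mul_sq _ _ _).trans ?_
    refine mul_le_mul_of_nonneg_right ?_ (sqConv_nonneg B v k)
    calc ∑ j ∈ B, √(freqRt k * (1 / freqRt j ^ 5)) ^ 2 = ∑ j ∈ B, freqRt k * (1 / freqRt j ^ 5) :=
          Finset.sum_congr rfl fun j hj => by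
            have : 0 < freqRt j := by linarith [one_le_freqRt (hB j hj)]
            exact Real.sq_sqrt (by positivity)
      _ ≤ freqRt k * Z := by rw [← Finset.mul_sum]; gcongr
  have hQ2 : Q ^ 2 ≤ mass B v ^ 2 / freqRt k ^ 4 := by
    have h0 : 0 ≤ ∑ j ∈ B, ‖v j‖ * ‖v (k - j)‖ := Finset.sum_nonneg fun _ _ => by positivity
    rw [hQ, ← Finset.mul_sum]
    calc _ ≤ (1 / freqRt k ^ 2 * mass B v) ^ 2 := by
          gcongr
          exact sum_norm_mul_norm_le hv k
      _ = _ := by field_simp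
  have h0 := fluxConv_nonneg B v k
  nlinarith [sq_nonneg (P - Q)]

lemma sum_high_fluxConv_le {B : Finset (ℤ × ℤ)} (hB : ∀ k ∈ B, k ≠ 0) {Z : ℝ}
    (hZ : ∑ k ∈ B, 1 / freqRt k ^ 5 ≤ Z) {v : ℤ × ℤ → ℂ} (hv : ∀ k, k ∉ B → v k = 0)
    {σ : ℝ} (hσ : 0 < σ) :
    ∑ k ∈ B with σ < freqRt k, fluxConv B v k ^ 2 / freqRt k ^ 4 ≤ 4 * Z * mass B v ^ 2 / σ ^ 3 := by
  have hZ0 : 0 ≤ Z := (Finset.sum_nonneg fun k _ => by unfold freqRt; positivity).trans hZ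
  calc ∑ k ∈ B with σ < freqRt k, fluxConv B v k ^ 2 / freqRt k ^ 4
      ≤ ∑ k ∈ B with σ < freqRt k, (2 * Z / σ ^ 3 * sqConv B v k +
          2 * mass B v ^ 2 / σ ^ 3 * (1 / freqRt k ^ 5)) := by
        refine Finset.sum_le_sum fun k hk => ?_
        obtain ⟨hkB, hkσ⟩ := Finset.mem_filter.1 hk
        have h1 := one_le_freqRt (hB k hkB)
        have hk0 : 0 < freqRt k := by linarith
        have hs := sqConv_nonneg B v k
        calc _ ≤ (2 * (freqRt k * Z * sqConv B v k) + 2 * (mass B v ^ 2 / freqRt k ^ 4)) /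
              freqRt k ^ 4 := by
              gcongr
              exact fluxConv_sq_le hB hZ hv (hB k hkB)
          _ = 2 * Z / freqRt k ^ 3 * sqConv B v k +
              2 * mass B v ^ 2 / freqRt k ^ 3 * (1 / freqRt k ^ 5) := by
              field_simp
          _ ≤ _ := by gcongr
    _ ≤ ∑ k ∈ B, (2 * Z / σ ^ 3 * sqConv B v k +
          2 * mass B v ^ 2 / σ ^ 3 * (1 / freqRt k ^ 5)) := by
        refine Finset.sum_le_sum_of_subset_of_nonneg (Finset.filter_subset _ _) fun k hk _ => ?_
        have hs := sqConv_nonneg B v k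
        have hk0 : 0 ≤ freqRt k := Real.sqrt_nonneg _
        positivity
    _ ≤ 2 * Z / σ ^ 3 * mass B v ^ 2 + 2 * mass B v ^ 2 / σ ^ 3 * Z := by
        rw [Finset.sum_add_distrib, ← Finset.mul_sum, ← Finset.mul_sum]
        gcongr
        exact sum_sqConv_le hv
    _ = _ := by ring

/-- This is the flux contribution to `velBound` after inverting the viscous term. The weight `|k|²`
is split as `|k|^(3/4) |k|^(5/4)`: the second factor is square summable with sum `Z`, the first is
handled by `fluxConv_sq_le` and `sum_sqConv_le`. -/
lemma sum_fluxConv_le {B : Finset (ℤ × ℤ)} (hB : ∀ k ∈ B, k ≠ 0) {Z : ℝ}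
    (hZ : ∑ k ∈ B, 1 / freqRt k ^ 5 ≤ Z) {v : ℤ × ℤ → ℂ} (hv : ∀ k, k ∉ B → v k = 0) :
    ∑ k ∈ B, fluxConv B v k / freqRt k ^ 4 ≤ 2 * Z * mass B v := by
  have hZ0 : 0 ≤ Z := (Finset.sum_nonneg fun k _ => by unfold freqRt; positivity).trans hZ
  have hM := mass_nonneg B v
  have hC : ∑ k ∈ B, (fluxConv B v k / freqRt k ^ (3 / 2 : ℝ)) ^ 2 ≤ 4 * Z * mass B v ^ 2 := by
    calc _ ≤ ∑ k ∈ B, (2 * Z * sqConv B v k + 2 * mass B v ^ 2 * (1 / freqRt k ^ 5)) := by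
          refine Finset.sum_le_sum fun k hk => ?_
          have h1 := one_le_freqRt (hB k hk)
          have hk0 : 0 < freqRt k := by linarith
          have hs := sqConv_nonneg B v k
          have h3 : (freqRt k ^ (3 / 2 : ℝ)) ^ 2 = freqRt k ^ 3 := by
            rw [← Real.rpow_mul_natCast hk0.le, ← Real.rpow_natCast]; norm_num
          rw [div_pow, h3]
          calc _ ≤ (2 * (freqRt k * Z * sqConv B v k) + 2 * (mass B v ^ 2 / freqRt k ^ 4)) /
                freqRt k ^ 3 := by
                gcongr
                exact fluxConv_sq_le hB hZ hv (hB k hk)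
            _ = 2 * Z * sqConv B v k * (1 / freqRt k ^ 2) +
                2 * mass B v ^ 2 * (1 / freqRt k ^ 7) := by
                field_simp
            _ ≤ 2 * Z * sqConv B v k * 1 + 2 * mass B v ^ 2 * (1 / freqRt k ^ 5) := by
                gcongr ?_ * ?_ + ?_ * ?_
                · rw [div_le_one (by positivity)]
                  exact one_le_pow₀ h1
                · exact one_div_le_one_div_of_le (by positivity)
                    (pow_le_pow_right₀ h1 (by norm_num))
            _ = _ := by ring
      _ ≤ 2 * Z * mass B v ^ 2 + 2 * mass B v ^ 2 * Z := by
          rw [Finset.sum_add_distrib, ← Finset.mul_sum, ← Finset.mul_sum]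
          gcongr
          exact sum_sqConv_le hv
      _ = _ := by ring
  calc ∑ k ∈ B, fluxConv B v k / freqRt k ^ 4
      = ∑ k ∈ B, fluxConv B v k / freqRt k ^ (3 / 2 : ℝ) * √(1 / freqRt k ^ 5) := by
        refine Finset.sum_congr rfl fun k hk => ?_
        have hk0 : 0 < freqRt k := by linarith [one_le_freqRt (hB k hk)]
        rw [Real.sqrt_div zero_le_one, Real.sqrt_one, div_mul_div_comm, mul_one,
          Real.sqrt_eq_rpow, ← Real.rpow_natCast, ← Real.rpow_natCast, ← Real.rpow_mul hk0.le,
          ← Real.rpow_add hk0]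
        norm_num
    _ ≤ √(4 * Z * mass B v ^ 2) * √Z := by
        refine (Real.sum_mul_le_sqrt_mul_sqrt B _ _).trans ?_
        refine mul_le_mul (Real.sqrt_le_sqrt hC) (Real.sqrt_le_sqrt ?_)
          (Real.sqrt_nonneg _) (Real.sqrt_nonneg _)
        refine le_trans (le_of_eq (Finset.sum_congr rfl fun k _ => ?_)) hZ
        exact Real.sq_sqrt (by unfold freqRt; positivity)
    _ = 2 * Z * mass B v := by
        rw [← Real.sqrt_mul (by positivity), show 4 * Z * mass B v ^ 2 * Z = (2 * Z * mass B v) ^ 2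
          by ring, Real.sqrt_sq (by positivity)]

lemma norm_advCoeff_self_le {B : Finset (ℤ × ℤ)} (hB : ∀ k ∈ B, k ≠ 0) (v : ℤ × ℤ → ℂ)
    (k : ℤ × ℤ) : ‖advCoeff B v v k‖ ≤ fluxConv B v k * freqRt k ^ 2 :=
  norm_advCoeff_le hB v v k

lemma advCoeff_sub_right (B : Finset (ℤ × ℤ)) (p c d : ℤ × ℤ → ℂ) (k : ℤ × ℤ) :
    advCoeff B p (c - d) k = advCoeff B p c k - advCoeff B p d k := by
  simp only [advCoeff, ← Finset.sum_sub_distrib]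
  exact Finset.sum_congr rfl fun j _ => by simp only [Pi.sub_apply]; ring

lemma advCoeff_add_left (B : Finset (ℤ × ℤ)) (p p' d : ℤ × ℤ → ℂ) (k : ℤ × ℤ) :
    advCoeff B (p + p') d k = advCoeff B p d k + advCoeff B p' d k := by
  simp only [advCoeff, ← Finset.sum_add_distrib]
  exact Finset.sum_congr rfl fun j _ => by simp only [Pi.add_apply]; ring

/-! ### Energy and enstrophy balance of one step. -/

/-- One step of the scheme in terms of Fourier coefficients. -/
structure IsStep (B : Finset (ℤ × ℤ)) (ν dt : ℝ) (v f w : ℤ × ℤ → ℂ) : Prop where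
  ne_zero : ∀ k ∈ B, k ≠ 0
  neg_mem : ∀ k ∈ B, -k ∈ B
  left_off : ∀ k, k ∉ B → v k = 0
  right_off : ∀ k, k ∉ B → w k = 0
  left_symm : ∀ k, v (-k) = star (v k)
  right_symm : ∀ k, w (-k) = star (w k)
  eq : ∀ k ∈ B, ((1 + ν * dt * freqSq k : ℝ) : ℂ) * w k =
    v k - dt * advCoeff B v v k + dt * f k

lemma two_mul_re_sub_mul_star (a b : ℂ) :
    2 * ((a - b) * star a).re = ‖a‖ ^ 2 + ‖b - a‖ ^ 2 - ‖b‖ ^ 2 := by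
  simp only [← Complex.normSq_eq_norm_sq, Complex.normSq_apply, Complex.star_def, Complex.mul_re,
    Complex.sub_re, Complex.sub_im, Complex.conj_re, Complex.conj_im]
  ring

lemma IsStep.eq_re {B : Finset (ℤ × ℤ)} {ν dt : ℝ} {v f w : ℤ × ℤ → ℂ}
    (h : IsStep B ν dt v f w) {k : ℤ × ℤ} (hk : k ∈ B) :
    ‖w k‖ ^ 2 + ‖v k - w k‖ ^ 2 - ‖v k‖ ^ 2 + 2 * ν * dt * (freqSq k * ‖w k‖ ^ 2) =
      -(2 * dt * (advCoeff B v v k * star (w k)).re) + 2 * dt * (f k * star (w k)).re := by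
  rw [← two_mul_re_sub_mul_star]
  have hn : ‖w k‖ ^ 2 = (w k * star (w k)).re := by
    rw [Complex.star_def, Complex.mul_conj, Complex.ofReal_re, Complex.normSq_eq_norm_sq]
  have he := congrArg (fun z => (z * star (w k)).re) (h.eq k hk)
  simp only [add_mul, sub_mul, Complex.add_re, Complex.sub_re, mul_assoc,
    Complex.re_ofReal_mul] at he ⊢
  rw [hn]
  linarith

/-- The implicit part is diagonal in `k`, so the balance is the sum of the modewise identities and
remains exact for any truncation `l` of `w`. -/
lemma IsStep.energy {B : Finset (ℤ × ℤ)} {ν dt : ℝ} {v f w l : ℤ × ℤ → ℂ}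
    (h : IsStep B ν dt v f w) (hl : ∀ k, l k = w k ∨ l k = 0) :
    mass B l + mass B (v - l) + 2 * ν * dt * enstrophy B l =
      mass B v - 2 * dt * (∑ k ∈ B, advCoeff B v v k * star (l k)).re +
        2 * dt * (∑ k ∈ B, f k * star (l k)).re := by
  have : ∑ k ∈ B, (‖l k‖ ^ 2 + ‖v k - l k‖ ^ 2 - ‖v k‖ ^ 2 +
      2 * ν * dt * (freqSq k * ‖l k‖ ^ 2)) =
      ∑ k ∈ B, (-(2 * dt * (advCoeff B v v k * star (l k)).re) +
        2 * dt * (f k * star (l k)).re) := by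
    refine Finset.sum_congr rfl fun k hk => ?_
    rcases hl k with h' | h'
    · rw [h']; exact h.eq_re hk
    · simp [h']
  simp only [Finset.sum_add_distrib, Finset.sum_sub_distrib, ← Finset.mul_sum,
    Finset.sum_neg_distrib, ← Complex.re_sum] at this
  simp only [mass, enstrophy, Pi.sub_apply]
  linarith

lemma IsStep.enstrophy_identity {B : Finset (ℤ × ℤ)} {ν dt : ℝ} {v f w : ℤ × ℤ → ℂ}
    (h : IsStep B ν dt v f w) :
    enstrophy B w + enstrophy B (v - w) +
        2 * ν * dt * mass B (fun k => (freqSq k : ℂ) * w k) =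
      enstrophy B v - 2 * dt * (∑ k ∈ B, advCoeff B v v k * star ((freqSq k : ℂ) * w k)).re +
        2 * dt * (∑ k ∈ B, f k * star ((freqSq k : ℂ) * w k)).re := by
  have hs : ∀ (z : ℂ) (k : ℤ × ℤ), (z * star ((freqSq k : ℂ) * w k)).re =
      freqSq k * (z * star (w k)).re := by
    intro z k
    rw [← Complex.re_ofReal_mul, star_mul']
    congr 1
    simp only [Complex.star_def, Complex.conj_ofReal]
    ring
  have : ∑ k ∈ B, freqSq k * (‖w k‖ ^ 2 + ‖v k - w k‖ ^ 2 - ‖v k‖ ^ 2 +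
      2 * ν * dt * (freqSq k * ‖w k‖ ^ 2)) =
      ∑ k ∈ B, (-(2 * dt * (advCoeff B v v k * star ((freqSq k : ℂ) * w k)).re) +
        2 * dt * (f k * star ((freqSq k : ℂ) * w k)).re) := by
    refine Finset.sum_congr rfl fun k hk => ?_
    rw [h.eq_re hk, hs, hs]
    ring
  have hm : mass B (fun k => (freqSq k : ℂ) * w k) =
      ∑ k ∈ B, freqSq k * (freqSq k * ‖w k‖ ^ 2) := by
    refine Finset.sum_congr rfl fun k _ => ?_
    rw [norm_mul, Complex.norm_real, Real.norm_eq_abs, mul_pow, sq_abs]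
    ring
  rw [hm]
  simp only [mul_add, mul_sub, mul_left_comm (freqSq _) (2 * ν * dt), Finset.sum_add_distrib,
    Finset.sum_sub_distrib, ← Finset.mul_sum, Finset.sum_neg_distrib, ← Complex.re_sum] at this
  simp only [enstrophy, Pi.sub_apply]
  linarith

lemma IsStep.mass_add_enstrophy_le {B : Finset (ℤ × ℤ)} {ν dt F : ℝ} {v f w : ℤ × ℤ → ℂ}
    (h : IsStep B ν dt v f w) (hν : 0 < ν) (hdt : 0 < dt) (hF : 0 ≤ F) (hf : mass B f ≤ F ^ 2)
    (hU : dt * velBound B v ^ 2 ≤ ν / 2) :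
    mass B w + ν / 2 * dt * enstrophy B w ≤ mass B v + dt * (F ^ 2 / ν) := by
  have he := h.energy (l := w) fun k => Or.inl rfl
  have hadv : ∑ k ∈ B, advCoeff B v v k * star (w k) =
      ∑ k ∈ B, advCoeff B v (v - w) k * star (w k) := by
    simp_rw [advCoeff_sub_right, sub_mul]
    rw [Finset.sum_sub_distrib, sum_advCoeff_mul_self h.neg_mem v h.right_off h.right_symm, sub_zero]
  have h1 : -(∑ k ∈ B, advCoeff B v v k * star (w k)).re ≤
      velBound B v * (√(mass B (v - w)) * √(enstrophy B w)) := by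
    rw [hadv, ← Complex.neg_re]
    refine (Complex.re_le_norm _).trans ?_
    rw [norm_neg]
    exact norm_sum_advCoeff_mul_le h.ne_zero v
      (fun k hk => by simp [h.left_off k hk, h.right_off k hk]) w
  have h2 : (∑ k ∈ B, f k * star (w k)).re ≤ F * √(enstrophy B w) := by
    refine (Complex.re_le_norm _).trans ((norm_sum_mul_star_le B f w).trans ?_)
    exact mul_le_mul ((Real.sqrt_le_left hF).2 hf)
      (Real.sqrt_le_sqrt (mass_le_enstrophy h.ne_zero w)) (Real.sqrt_nonneg _) hF
  set D := √(mass B (v - w))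
  set X := √(enstrophy B w)
  have hD : mass B (v - w) = D ^ 2 := (Real.sq_sqrt (mass_nonneg _ _)).symm
  have hX : enstrophy B w = X ^ 2 := (Real.sq_sqrt (enstrophy_nonneg _ _)).symm
  rw [hD, hX] at he
  rw [hX]
  set U := velBound B v
  -- Of the `2 ν dt X²` available, advection takes `ν / 2`, the forcing takes `ν`, and `ν / 2`
  -- survives.
  have h3 : 2 * dt * (U * (D * X)) ≤ D ^ 2 + ν / 2 * dt * X ^ 2 := by
    have : dt * U ^ 2 * (dt * X ^ 2) ≤ ν / 2 * (dt * X ^ 2) := by gcongr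
    nlinarith [sq_nonneg (D - dt * U * X)]
  have h4 : 2 * dt * (F * X) ≤ ν * dt * X ^ 2 + dt * (F ^ 2 / ν) := by
    have : 2 * (F * X) ≤ ν * X ^ 2 + F ^ 2 / ν := by
      have h5 : 0 ≤ (ν * X - F) ^ 2 / ν := by positivity
      have h6 : (ν * X - F) ^ 2 / ν = ν * X ^ 2 - 2 * (F * X) + F ^ 2 / ν := by
        field_simp
        ring
      linarith
    nlinarith
  have h5 := mul_le_mul_of_nonneg_left h1 (by positivity : 0 ≤ 2 * dt)
  have h6 := mul_le_mul_of_nonneg_left h2 (by positivity : 0 ≤ 2 * dt)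
  linarith

/-- No cancellation is used: advection and forcing each spend one half of the viscous term `2 ν dt
‖Δw‖²`, and `velBound_le_enstrophy` makes the advection quadratic in the enstrophy of `v`. -/
lemma IsStep.enstrophy_le {B : Finset (ℤ × ℤ)} {ν dt F Z : ℝ} {v f w : ℤ × ℤ → ℂ}
    (h : IsStep B ν dt v f w) (hν : 0 < ν) (hdt : 0 < dt) (hF : 0 ≤ F) (hf : mass B f ≤ F ^ 2)
    (hZ : ∑ k ∈ B, 1 / freqRt k ^ 5 ≤ Z) :
    enstrophy B w ≤ enstrophy B v * (1 + dt * (Z / ν * enstrophy B v)) + dt * (F ^ 2 / ν) := by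
  have he := h.enstrophy_identity
  set y : ℤ × ℤ → ℂ := fun k => (freqSq k : ℂ) * w k
  have h1 : -(∑ k ∈ B, advCoeff B v v k * star (y k)).re ≤
      velBound B v * (√(enstrophy B v) * √(mass B y)) := by
    rw [← Complex.neg_re]
    refine (Complex.re_le_norm _).trans ?_
    rw [norm_neg]
    exact norm_sum_advCoeff_mul_le_grad h.ne_zero v h.left_off y
  have h2 : (∑ k ∈ B, f k * star (y k)).re ≤ F * √(mass B y) := by
    refine (Complex.re_le_norm _).trans ((norm_sum_mul_star_le B f y).trans ?_)
    exact mul_le_mul_of_nonneg_right ((Real.sqrt_le_left hF).2 hf) (Real.sqrt_nonneg _)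
  have h3 := velBound_le_enstrophy h.ne_zero hZ v
  have h0 := enstrophy_nonneg B (v - w)
  set Y := √(mass B y)
  set X := √(enstrophy B v)
  have hY : mass B y = Y ^ 2 := (Real.sq_sqrt (mass_nonneg _ _)).symm
  have hX : enstrophy B v = X ^ 2 := (Real.sq_sqrt (enstrophy_nonneg _ _)).symm
  rw [hY, hX] at he
  rw [hX] at h3 ⊢
  set U := velBound B v
  have young : ∀ b : ℝ, 2 * (b * Y) ≤ ν * Y ^ 2 + b ^ 2 / ν := by
    intro b
    have h5 : 0 ≤ (ν * Y - b) ^ 2 / ν := by positivity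
    have h6 : (ν * Y - b) ^ 2 / ν = ν * Y ^ 2 - 2 * (b * Y) + b ^ 2 / ν := by
      field_simp
      ring
    linarith
  have h4 : (U * X) ^ 2 / ν ≤ Z / ν * X ^ 2 * X ^ 2 := by
    rw [mul_pow, div_mul_eq_mul_div, div_mul_eq_mul_div]
    gcongr
  have h5 := mul_le_mul_of_nonneg_left h1 (by positivity : 0 ≤ 2 * dt)
  have h6 := mul_le_mul_of_nonneg_left h2 (by positivity : 0 ≤ 2 * dt)
  have h7 := mul_le_mul_of_nonneg_left ((young (U * X)).trans (add_le_add_right h4 _)) hdt.le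
  have h8 := mul_le_mul_of_nonneg_left (young F) hdt.le
  nlinarith

/-! ### Smoothing of the velocity by one implicit step. -/

lemma IsStep.norm_mul_le {B : Finset (ℤ × ℤ)} {ν dt : ℝ} {v f w : ℤ × ℤ → ℂ}
    (h : IsStep B ν dt v f w) (hν : 0 < ν) (hdt : 0 < dt) {k : ℤ × ℤ} (hk : k ∈ B) :
    (1 + ν * dt * freqRt k ^ 4) * ‖w k‖ ≤
      ‖v k‖ + dt * (fluxConv B v k * freqRt k ^ 2) + dt * ‖f k‖ := by
  have he := congrArg norm (h.eq k hk)
  have h0 : 0 ≤ 1 + ν * dt * freqSq k := by have := freqSq_nonneg k; positivity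
  rw [norm_mul, Complex.norm_real, Real.norm_of_nonneg h0] at he
  rw [freqRt_pow_four, he]
  refine (norm_add_le _ _).trans (add_le_add ((norm_sub_le _ _).trans (add_le_add le_rfl ?_)) ?_)
  · rw [norm_mul, Complex.norm_real, Real.norm_of_nonneg hdt.le]
    gcongr
    exact norm_advCoeff_self_le h.ne_zero v k
  · rw [norm_mul, Complex.norm_real, Real.norm_of_nonneg hdt.le]

/-- Data and forcing pass through the multiplier `ρ`, whose `ℓ²` norm is finite uniformly in the
truncation thanks to the resolvent. In the flux term the factor `dt` cancels against `ν dt |k|²`,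
leaving a bound independent of `dt`. -/
lemma IsStep.velBound_le {B : Finset (ℤ × ℤ)} {ν dt F M Z : ℝ} {v f w : ℤ × ℤ → ℂ}
    (h : IsStep B ν dt v f w) (hν : 0 < ν) (hdt : 0 < dt) (hF : 0 ≤ F) (hf : mass B f ≤ F ^ 2)
    (hM : 0 ≤ M) (hv : mass B v ≤ M ^ 2) (hZ : ∑ k ∈ B, 1 / freqRt k ^ 5 ≤ Z) :
    velBound B w ≤ √(Z / √(ν * dt)) * (M + dt * F) + 2 * Z * M ^ 2 / ν := by
  have hZ0 : 0 ≤ Z := (Finset.sum_nonneg fun k _ => by unfold freqRt; positivity).trans hZ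
  set ρ : ℤ × ℤ → ℝ := fun k => 1 / ((1 + ν * dt * freqRt k ^ 4) * freqRt k ^ 2) with hρ
  have hρsum : ∑ k ∈ B, ρ k ^ 2 ≤ Z / √(ν * dt) := by
    calc ∑ k ∈ B, ρ k ^ 2 ≤ ∑ k ∈ B, 1 / √(ν * dt) * (1 / freqRt k ^ 5) := by
          refine Finset.sum_le_sum fun k hk => ?_
          have h1 := one_le_freqRt (h.ne_zero k hk)
          have h0 : 0 < freqRt k := by linarith
          have hτ : 0 < √(ν * dt) := Real.sqrt_pos.2 (by positivity)
          have hτ2 : ν * dt = √(ν * dt) ^ 2 := (Real.sq_sqrt (by positivity)).symm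
          simp only [hρ]
          rw [div_pow, one_pow, div_mul_div_comm, one_mul]
          refine one_div_le_one_div_of_le (by positivity) ?_
          rw [hτ2, Real.sqrt_sq hτ.le]
          set τ := √(ν * dt)
          have ha : τ * freqRt k ≤ 1 + τ ^ 2 * freqRt k ^ 4 := by
            have : τ * freqRt k ≤ τ * freqRt k ^ 2 := by
              gcongr
              exact le_self_pow₀ h1 (by norm_num)
            nlinarith [sq_nonneg (τ * freqRt k ^ 2 - 1), mul_pos hτ h0]
          have hb : 1 ≤ 1 + τ ^ 2 * freqRt k ^ 4 := by
            have : 0 ≤ τ ^ 2 * freqRt k ^ 4 := by positivity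
            linarith
          calc τ * freqRt k ^ 5 = τ * freqRt k * 1 * freqRt k ^ 4 := by ring
            _ ≤ (1 + τ ^ 2 * freqRt k ^ 4) * (1 + τ ^ 2 * freqRt k ^ 4) * freqRt k ^ 4 := by gcongr
            _ = _ := by ring
      _ ≤ _ := by
          rw [← Finset.mul_sum, div_eq_mul_one_div Z, mul_comm Z]
          gcongr
  have hpt : ∀ k ∈ B, ‖w k‖ / freqRt k ^ 2 ≤
      ρ k * ‖v k‖ + dt * (ρ k * ‖f k‖) + 1 / ν * (fluxConv B v k / freqRt k ^ 4) := by
    intro k hk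
    have h1 := one_le_freqRt (h.ne_zero k hk)
    have h0 : 0 < freqRt k := by linarith
    have hc := fluxConv_nonneg B v k
    have hr : 0 < 1 + ν * dt * freqRt k ^ 4 := by positivity
    have hw : ‖w k‖ ≤ (‖v k‖ + dt * (fluxConv B v k * freqRt k ^ 2) + dt * ‖f k‖) /
        (1 + ν * dt * freqRt k ^ 4) := by
      rw [le_div_iff₀ hr, mul_comm]
      exact h.norm_mul_le hν hdt hk
    calc ‖w k‖ / freqRt k ^ 2
        ≤ (‖v k‖ + dt * (fluxConv B v k * freqRt k ^ 2) + dt * ‖f k‖) /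
        (1 + ν * dt * freqRt k ^ 4) / freqRt k ^ 2 := by gcongr
      _ = ρ k * ‖v k‖ + dt * (ρ k * ‖f k‖) +
          dt * fluxConv B v k / (1 + ν * dt * freqRt k ^ 4) := by
          simp only [hρ]
          field_simp
          ring
      _ ≤ ρ k * ‖v k‖ + dt * (ρ k * ‖f k‖) +
          dt * fluxConv B v k / (ν * dt * freqRt k ^ 4) := by
          gcongr
          linarith
      _ = _ := by field_simp
  calc velBound B w ≤ ∑ k ∈ B, (ρ k * ‖v k‖ + dt * (ρ k * ‖f k‖) +
        1 / ν * (fluxConv B v k / freqRt k ^ 4)) := Finset.sum_le_sum hpt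
    _ = ∑ k ∈ B, ρ k * ‖v k‖ + dt * ∑ k ∈ B, ρ k * ‖f k‖ +
        1 / ν * ∑ k ∈ B, fluxConv B v k / freqRt k ^ 4 := by
        simp only [Finset.sum_add_distrib, Finset.mul_sum]
    _ ≤ √(Z / √(ν * dt)) * M + dt * (√(Z / √(ν * dt)) * F) + 1 / ν * (2 * Z * M ^ 2) := by
        gcongr
        · refine (Real.sum_mul_le_sqrt_mul_sqrt B _ _).trans ?_
          exact mul_le_mul (Real.sqrt_le_sqrt hρsum) ((Real.sqrt_le_left hM).2 hv)
            (Real.sqrt_nonneg _) (Real.sqrt_nonneg _)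
        · refine (Real.sum_mul_le_sqrt_mul_sqrt B _ _).trans ?_
          exact mul_le_mul (Real.sqrt_le_sqrt hρsum) ((Real.sqrt_le_left hF).2 hf)
            (Real.sqrt_nonneg _) (Real.sqrt_nonneg _)
        · refine (sum_fluxConv_le h.ne_zero hZ h.left_off).trans ?_
          gcongr
    _ = _ := by ring

/-! ### The first step, from data bounded only in `L²`. -/

/-- The truncation of a coefficient sequence to the frequencies with `|k| ≤ σ²`. -/
def lowPart (σ : ℝ) (c : ℤ × ℤ → ℂ) (k : ℤ × ℤ) : ℂ := if freqRt k ≤ σ then c k else 0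

lemma lowPart_eq_or (σ : ℝ) (c : ℤ × ℤ → ℂ) (k : ℤ × ℤ) :
    lowPart σ c k = c k ∨ lowPart σ c k = 0 := by
  unfold lowPart
  split_ifs <;> simp

lemma velBound_lowPart_le {B : Finset (ℤ × ℤ)} (hB : ∀ k ∈ B, k ≠ 0) {Z : ℝ}
    (hZ : ∑ k ∈ B, 1 / freqRt k ^ 5 ≤ Z) {σ : ℝ} (hσ : 0 < σ) (c : ℤ × ℤ → ℂ) :
    velBound B (lowPart σ c) ^ 2 ≤ σ * Z * mass B c := by
  calc velBound B (lowPart σ c) ^ 2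
      = (∑ k ∈ B, (if freqRt k ≤ σ then 1 / freqRt k ^ 2 else 0) * ‖c k‖) ^ 2 := by
        congr 1
        refine Finset.sum_congr rfl fun k _ => ?_
        unfold lowPart
        split_ifs
        · ring
        · simp
    _ ≤ (∑ k ∈ B, (if freqRt k ≤ σ then 1 / freqRt k ^ 2 else 0) ^ 2) * mass B c :=
        Finset.sum_mul_sq_le_sq_mul_sq _ _ _
    _ ≤ (∑ k ∈ B, σ * (1 / freqRt k ^ 5)) * mass B c := by
        refine mul_le_mul_of_nonneg_right (Finset.sum_le_sum fun k hk => ?_) (mass_nonneg B c)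
        have h0 : 0 < freqRt k := by linarith [one_le_freqRt (hB k hk)]
        split_ifs with h
        · rw [div_pow, one_pow, ← pow_mul, mul_one_div, div_le_div_iff₀ (by positivity)
            (by positivity)]
          calc 1 * freqRt k ^ 5 = freqRt k * freqRt k ^ 4 := by ring
            _ ≤ _ := by gcongr
        · rw [zero_pow two_ne_zero]; positivity
    _ ≤ _ := by
        rw [← Finset.mul_sum]
        have := mass_nonneg B c
        gcongr

/-- A velocity of frequencies above `σ'²` gains `1/σ'²` in each convolution coefficient. Passing
from a sup bound in `k` to `ℓ²` costs the square root of the number of modes with `|k| ≤ σ²`, which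
is at most `σ⁵ Z`. -/
lemma norm_sum_advCoeff_high_low_le {B : Finset (ℤ × ℤ)} (hB : ∀ k ∈ B, k ≠ 0) {Z : ℝ}
    (hZ : ∑ k ∈ B, 1 / freqRt k ^ 5 ≤ Z) {σ σ' : ℝ} (hσ : 0 < σ) (hσ' : 0 < σ')
    {v : ℤ × ℤ → ℂ} (hv : ∀ k, k ∉ B → v k = 0) (w : ℤ × ℤ → ℂ) :
    ‖∑ k ∈ B, advCoeff B (v - lowPart σ' v) v k * star (lowPart σ w k)‖ ≤
      mass B v / σ' ^ 2 * √(σ ^ 5 * Z) * √(enstrophy B (lowPart σ w)) := by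
  have hconv : ∀ k, ∑ j ∈ B, ‖(v - lowPart σ' v) j‖ / freqRt j ^ 2 * ‖v (k - j)‖ ≤
      mass B v / σ' ^ 2 := by
    intro k
    calc _ ≤ ∑ j ∈ B, 1 / σ' ^ 2 * (‖v j‖ * ‖v (k - j)‖) := by
          refine Finset.sum_le_sum fun j hj => ?_
          rw [← mul_assoc]
          refine mul_le_mul_of_nonneg_right ?_ (norm_nonneg _)
          simp only [Pi.sub_apply, lowPart]
          split_ifs with h
          · simp only [sub_self, norm_zero, zero_div]; positivity
          · rw [sub_zero, div_eq_mul_one_div, mul_comm]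
            gcongr
            exact (not_le.1 h).le
      _ ≤ 1 / σ' ^ 2 * mass B v := by
          rw [← Finset.mul_sum]
          gcongr
          exact sum_norm_mul_norm_le hv k
      _ = _ := by ring
  calc _ ≤ ∑ k ∈ B, mass B v / σ' ^ 2 *
        ((if freqRt k ≤ σ then 1 else 0) * (freqRt k ^ 2 * ‖lowPart σ w k‖)) := by
        refine (norm_sum_le _ _).trans (Finset.sum_le_sum fun k _ => ?_)
        have h1 : (if freqRt k ≤ σ then (1 : ℝ) else 0) * (freqRt k ^ 2 * ‖lowPart σ w k‖) =
            freqRt k ^ 2 * ‖lowPart σ w k‖ := by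
          unfold lowPart
          split_ifs <;> simp
        rw [h1, norm_mul, norm_star, ← mul_assoc]
        refine mul_le_mul_of_nonneg_right ((norm_advCoeff_le hB _ v k).trans ?_) (norm_nonneg _)
        exact mul_le_mul_of_nonneg_right (hconv k) (by positivity)
    _ ≤ mass B v / σ' ^ 2 * (√(∑ k ∈ B, (if freqRt k ≤ σ then (1 : ℝ) else 0) ^ 2) *
        √(∑ k ∈ B, (freqRt k ^ 2 * ‖lowPart σ w k‖) ^ 2)) := by
        rw [← Finset.mul_sum]
        refine mul_le_mul_of_nonneg_left (Real.sum_mul_le_sqrt_mul_sqrt B _ _) ?_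
        have := mass_nonneg B v
        positivity
    _ ≤ _ := by
        have hm := mass_nonneg B v
        rw [mul_assoc (mass B v / σ' ^ 2)]
        gcongr
        · calc _ ≤ ∑ k ∈ B, σ ^ 5 * (1 / freqRt k ^ 5) := by
                refine Finset.sum_le_sum fun k hk => ?_
                have h0 : 0 < freqRt k := by linarith [one_le_freqRt (hB k hk)]
                split_ifs with h
                · rw [one_pow, mul_one_div, one_le_div (by positivity)]
                  gcongr
                · rw [zero_pow two_ne_zero]; positivity
            _ ≤ _ := by rw [← Finset.mul_sum]; gcongr
        · refine le_of_eq (Finset.sum_congr rfl fun k _ => ?_)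
          rw [← freqRt_pow_four]
          ring

/-- Each high mode is bounded by dividing the equation by `ν dt |k|²`. Above the cutoff `v` agrees
with `v - lowPart σ w`, so the data term is a multiple of the numerical dissipation of the low-mode
balance and can be absorbed there. -/
lemma IsStep.high_mass_le {B : Finset (ℤ × ℤ)} {ν dt F Z σ : ℝ} {v f w : ℤ × ℤ → ℂ}
    (h : IsStep B ν dt v f w) (hν : 0 < ν) (hdt : 0 < dt) (hf : mass B f ≤ F ^ 2)
    (hZ : ∑ k ∈ B, 1 / freqRt k ^ 5 ≤ Z) (hσ : 0 < σ) :
    ∑ k ∈ B with σ < freqRt k, ‖w k‖ ^ 2 ≤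
      3 * (mass B (v - lowPart σ w) / (ν * dt * σ ^ 4) ^ 2 +
        4 * Z * mass B v ^ 2 / σ ^ 3 / ν ^ 2 + F ^ 2 / (ν * σ ^ 4) ^ 2) := by
  have hlow : ∑ k ∈ B with σ < freqRt k, ‖v k‖ ^ 2 ≤ mass B (v - lowPart σ w) := by
    calc _ = ∑ k ∈ B with σ < freqRt k, ‖(v - lowPart σ w) k‖ ^ 2 := by
          refine Finset.sum_congr rfl fun k hk => ?_
          simp [lowPart, not_le.2 (Finset.mem_filter.1 hk).2]
      _ ≤ _ := Finset.sum_le_sum_of_subset_of_nonneg (Finset.filter_subset _ _)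
          fun _ _ _ => by positivity
  have hforce : ∑ k ∈ B with σ < freqRt k, ‖f k‖ ^ 2 ≤ F ^ 2 :=
    (Finset.sum_le_sum_of_subset_of_nonneg (Finset.filter_subset _ _)
          fun _ _ _ => by positivity).trans hf
  have hflux := sum_high_fluxConv_le h.ne_zero hZ h.left_off hσ
  calc _ ≤ ∑ k ∈ B with σ < freqRt k, (3 * (1 / (ν * dt * σ ^ 4) ^ 2 * ‖v k‖ ^ 2 +
        1 / ν ^ 2 * (fluxConv B v k ^ 2 / freqRt k ^ 4) + 1 / (ν * σ ^ 4) ^ 2 * ‖f k‖ ^ 2)) := by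
        refine Finset.sum_le_sum fun k hk => ?_
        obtain ⟨hkB, hkσ⟩ := Finset.mem_filter.1 hk
        have h0 : 0 < freqRt k := by linarith
        have hc := fluxConv_nonneg B v k
        have hle : ‖w k‖ ≤ ‖v k‖ / (ν * dt * σ ^ 4) + fluxConv B v k / freqRt k ^ 2 / ν +
            ‖f k‖ / (ν * σ ^ 4) := by
          calc ‖w k‖ ≤ (‖v k‖ + dt * (fluxConv B v k * freqRt k ^ 2) + dt * ‖f k‖) /
                (ν * dt * freqRt k ^ 4) := by
                rw [le_div_iff₀ (by positivity), mul_comm]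
                refine le_trans ?_ (h.norm_mul_le hν hdt hkB)
                gcongr
                linarith
            _ = ‖v k‖ / (ν * dt * freqRt k ^ 4) + fluxConv B v k / freqRt k ^ 2 / ν +
                ‖f k‖ / (ν * freqRt k ^ 4) := by
                field_simp
            _ ≤ _ := by gcongr
        calc ‖w k‖ ^ 2 ≤ (‖v k‖ / (ν * dt * σ ^ 4) + fluxConv B v k / freqRt k ^ 2 / ν +
            ‖f k‖ / (ν * σ ^ 4)) ^ 2 := by gcongr
          _ ≤ 3 * ((‖v k‖ / (ν * dt * σ ^ 4)) ^ 2 + (fluxConv B v k / freqRt k ^ 2 / ν) ^ 2 +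
            (‖f k‖ / (ν * σ ^ 4)) ^ 2) := by
              set a := ‖v k‖ / (ν * dt * σ ^ 4)
              set b := fluxConv B v k / freqRt k ^ 2 / ν
              set c := ‖f k‖ / (ν * σ ^ 4)
              nlinarith [sq_nonneg (a - b), sq_nonneg (b - c), sq_nonneg (a - c)]
          _ = _ := by
              field_simp
    _ = 3 * (1 / (ν * dt * σ ^ 4) ^ 2 * ∑ k ∈ B with σ < freqRt k, ‖v k‖ ^ 2 +
        1 / ν ^ 2 * ∑ k ∈ B with σ < freqRt k, fluxConv B v k ^ 2 / freqRt k ^ 4 +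
        1 / (ν * σ ^ 4) ^ 2 * ∑ k ∈ B with σ < freqRt k, ‖f k‖ ^ 2) := by
        simp only [Finset.mul_sum, Finset.sum_add_distrib, mul_add]
    _ ≤ 3 * (1 / (ν * dt * σ ^ 4) ^ 2 * mass B (v - lowPart σ w) +
        1 / ν ^ 2 * (4 * Z * mass B v ^ 2 / σ ^ 3) + 1 / (ν * σ ^ 4) ^ 2 * F ^ 2) := by
        gcongr
    _ = _ := by ring

lemma two_mul_mul_le_of_pos {p : ℝ} (hp : 0 < p) (b x : ℝ) :
    2 * (b * x) ≤ p * x ^ 2 + b ^ 2 / p := by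
  have h5 : 0 ≤ (p * x - b) ^ 2 / p := by positivity
  have h6 : (p * x - b) ^ 2 / p = p * x ^ 2 - 2 * (b * x) + b ^ 2 / p := by
    field_simp
    ring
  linarith

/-- With `l` the low part of `w`, the advection is `b(v_low, v - l, l) + b(v_high, v, l)`. The low
velocity has a finite `velBound` and is absorbed as in the energy estimate; the high velocity leaves
the small last term. The constants leave room for the high modes of `w`. -/
lemma IsStep.low_mass_le {B : Finset (ℤ × ℤ)} {ν dt F Z σ σ' : ℝ} {v f w : ℤ × ℤ → ℂ}
    (h : IsStep B ν dt v f w) (hν : 0 < ν) (hdt : 0 < dt) (hF : 0 ≤ F) (hf : mass B f ≤ F ^ 2)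
    (hZ : ∑ k ∈ B, 1 / freqRt k ^ 5 ≤ Z) (hσ : 0 < σ) (hσ' : 0 < σ')
    (hU : dt * (σ' * Z * mass B v) ≤ ν / 16) :
    mass B (lowPart σ w) + mass B (v - lowPart σ w) / 2 +
        5 / 8 * (ν * dt * enstrophy B (lowPart σ w)) ≤
      mass B v + 8 / 9 * (dt * (F ^ 2 / ν)) +
        8 * dt / ν * (mass B v ^ 2 * Z * σ ^ 5 / σ' ^ 4) := by
  have hZ0 : 0 ≤ Z := (Finset.sum_nonneg fun k _ => by unfold freqRt; positivity).trans hZ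
  set l := lowPart σ w with hl
  have hloff : ∀ k, k ∉ B → l k = 0 := fun k hk => by simp [hl, lowPart, h.right_off k hk]
  have hlsymm : ∀ k, l (-k) = star (l k) := by
    intro k
    have : freqRt (-k) = freqRt k := by simp [freqRt, freqSq_neg]
    simp only [hl, lowPart, this, h.right_symm]
    split_ifs <;> simp
  have he := h.energy (l := l) (lowPart_eq_or σ w)
  have hadv : ∑ k ∈ B, advCoeff B v v k * star (l k) =
      ∑ k ∈ B, advCoeff B (lowPart σ' v) (v - l) k * star (l k) +
        ∑ k ∈ B, advCoeff B (v - lowPart σ' v) v k * star (l k) := by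
    have h1 := sum_advCoeff_mul_self h.neg_mem (lowPart σ' v) hloff hlsymm
    simp_rw [advCoeff_sub_right, sub_mul]
    rw [Finset.sum_sub_distrib, h1, sub_zero, ← Finset.sum_add_distrib]
    refine Finset.sum_congr rfl fun k _ => ?_
    rw [← add_mul, ← advCoeff_add_left, add_sub_cancel]
  have hvl : ∀ k, k ∉ B → (v - l) k = 0 := fun k hk => by
    simp [h.left_off k hk, hloff k hk]
  have h1 : -(∑ k ∈ B, advCoeff B v v k * star (l k)).re ≤
      velBound B (lowPart σ' v) * (√(mass B (v - l)) * √(enstrophy B l)) +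
        mass B v / σ' ^ 2 * √(σ ^ 5 * Z) * √(enstrophy B l) := by
    rw [← Complex.neg_re]
    refine (Complex.re_le_norm _).trans ?_
    rw [norm_neg, hadv]
    exact (norm_add_le _ _).trans (add_le_add
      (norm_sum_advCoeff_mul_le h.ne_zero _ hvl l)
      (norm_sum_advCoeff_high_low_le h.ne_zero hZ hσ hσ' h.left_off w))
  have h2 : (∑ k ∈ B, f k * star (l k)).re ≤ F * √(enstrophy B l) := by
    refine (Complex.re_le_norm _).trans ((norm_sum_mul_star_le B f l).trans ?_)
    exact mul_le_mul ((Real.sqrt_le_left hF).2 hf)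
      (Real.sqrt_le_sqrt (mass_le_enstrophy h.ne_zero l)) (Real.sqrt_nonneg _) hF
  have hUsq := velBound_lowPart_le h.ne_zero hZ hσ' v
  have hE : (mass B v / σ' ^ 2 * √(σ ^ 5 * Z)) ^ 2 = mass B v ^ 2 * Z * σ ^ 5 / σ' ^ 4 := by
    rw [mul_pow, Real.sq_sqrt (by positivity)]
    field_simp
  rw [← hE]
  set E := mass B v / σ' ^ 2 * √(σ ^ 5 * Z)
  set D := √(mass B (v - l))
  set X := √(enstrophy B l)
  have hD : mass B (v - l) = D ^ 2 := (Real.sq_sqrt (mass_nonneg _ _)).symm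
  have hX : enstrophy B l = X ^ 2 := (Real.sq_sqrt (enstrophy_nonneg _ _)).symm
  rw [hD, hX] at he
  rw [hD, hX]
  set U := velBound B (lowPart σ' v)
  have hU' : dt * U ^ 2 ≤ ν / 16 := (mul_le_mul_of_nonneg_left hUsq hdt.le).trans hU
  have h3 : 2 * dt * (U * (D * X)) ≤ D ^ 2 / 2 + ν / 8 * dt * X ^ 2 := by
    have : dt * U ^ 2 * (dt * X ^ 2) ≤ ν / 16 * (dt * X ^ 2) := by gcongr
    nlinarith [sq_nonneg (D - 2 * (dt * U * X))]
  have h4 := mul_le_mul_of_nonneg_left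
    (two_mul_mul_le_of_pos (by positivity : 0 < ν / 8) E X) hdt.le
  have h5 := mul_le_mul_of_nonneg_left
    (two_mul_mul_le_of_pos (by positivity : 0 < 9 / 8 * ν) F X) hdt.le
  have h6 := mul_le_mul_of_nonneg_left h1 (by positivity : 0 ≤ 2 * dt)
  have h7 := mul_le_mul_of_nonneg_left h2 (by positivity : 0 ≤ 2 * dt)
  have h8 : E ^ 2 / (ν / 8) = 8 / ν * E ^ 2 := by field_simp
  have h9 : F ^ 2 / (9 / 8 * ν) = 8 / 9 * (F ^ 2 / ν) := by field_simp
  have h10 : 8 * dt / ν * E ^ 2 = dt * (8 / ν * E ^ 2) := by ring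
  rw [h8] at h4
  rw [h9] at h5
  rw [h10]
  linarith

lemma mass_eq_low_add_high (B : Finset (ℤ × ℤ)) (σ : ℝ) (w : ℤ × ℤ → ℂ) :
    mass B w = mass B (lowPart σ w) + ∑ k ∈ B with σ < freqRt k, ‖w k‖ ^ 2 := by
  rw [Finset.sum_filter, mass, mass, ← Finset.sum_add_distrib]
  refine Finset.sum_congr rfl fun k _ => ?_
  unfold lowPart
  by_cases h : freqRt k ≤ σ
  · simp [h, not_lt.2 h]
  · simp [h, not_le.1 h]

lemma mass_le_two_mul (B : Finset (ℤ × ℤ)) (v l : ℤ × ℤ → ℂ) :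
    mass B v ≤ 2 * mass B (v - l) + 2 * mass B l := by
  simp only [mass, Finset.mul_sum, ← Finset.sum_add_distrib]
  refine Finset.sum_le_sum fun k _ => ?_
  have h : ‖v k‖ ≤ ‖(v - l) k‖ + ‖l k‖ := by
    simpa using norm_add_le ((v - l) k) (l k)
  nlinarith [sq_nonneg (‖(v - l) k‖ - ‖l k‖), norm_nonneg (v k)]

/-- A step from square summable data, without any bound on the velocity. -/
lemma IsStep.mass_le_of_small {B : Finset (ℤ × ℤ)} {ν h F Z a η c₀ : ℝ} {v f w : ℤ × ℤ → ℂ}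
    (hs : IsStep B ν (h ^ 2) v f w) (hν : 0 < ν) (hh : 0 < h) (hF : 0 ≤ F)
    (hf : mass B f ≤ F ^ 2) (hZ : ∑ k ∈ B, 1 / freqRt k ^ 5 ≤ Z) (hc₀ : 1 ≤ c₀)
    (ha : mass B v ≤ a ^ 2) (hη : 0 < η) (h₁ : η * (Z * a ^ 2) ≤ ν / 16)
    (h₂ : 256 * (Z * a ^ 2) * h ^ 3 ≤ ν ^ 2 * η ^ 4) (h₃ : 768 * (Z * a ^ 2) * h ≤ ν ^ 3)
    (h₄ : ν * h ^ 2 ≤ 2) (h₅ : 24 * h ^ 4 ≤ ν ^ 2) (h₆ : 54 * h ^ 6 ≤ ν) :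
    (1 + ν / (2 * c₀ ^ 2) * h ^ 2) * mass B w ≤ mass B v + h ^ 2 * (F ^ 2 / ν) := by
  have hZ0 : 0 ≤ Z := (Finset.sum_nonneg fun k _ => by unfold freqRt; positivity).trans hZ
  -- With `dt = h²`, the output is cut at `|k| = h⁻²` and the velocity at `|k| = η² h⁻⁴`. Then `dt
  -- σ'` stays equal to `η`, while `σ⁵ / σ'⁴ = h³ / η⁴` is small.
  have hσ : 0 < 1 / h := by positivity
  have hσ' : 0 < η / h ^ 2 := by positivity
  have hdt : 0 < h ^ 2 := by positivity
  have hm0 := mass_nonneg B v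
  have hZm : Z * mass B v ≤ Z * a ^ 2 := by gcongr
  have hlow := hs.low_mass_le hν hdt hF hf hZ hσ hσ' (by
    calc h ^ 2 * (η / h ^ 2 * Z * mass B v) = η * (Z * mass B v) := by field_simp
      _ ≤ η * (Z * a ^ 2) := by gcongr
      _ ≤ _ := h₁)
  have hhigh := hs.high_mass_le hν hdt hf hZ hσ
  rw [mass_eq_low_add_high B (1 / h) w]
  have hm := mass_le_two_mul B v (lowPart (1 / h) w)
  have hLX := mass_le_enstrophy hs.ne_zero (lowPart (1 / h) w)
  have hL0 := mass_nonneg B (lowPart (1 / h) w)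
  have hD0 := mass_nonneg B (v - lowPart (1 / h) w)
  have hH0 : 0 ≤ ∑ k ∈ B with 1 / h < freqRt k, ‖w k‖ ^ 2 :=
    Finset.sum_nonneg fun _ _ => by positivity
  set m := mass B v
  set L := mass B (lowPart (1 / h) w)
  set D := mass B (v - lowPart (1 / h) w)
  set X := enstrophy B (lowPart (1 / h) w)
  set H := ∑ k ∈ B with 1 / h < freqRt k, ‖w k‖ ^ 2
  have hα : ν / (2 * c₀ ^ 2) ≤ ν / 2 := by
    apply div_le_div_of_nonneg_left hν.le (by norm_num)
    nlinarith
  have hα0 : 0 ≤ ν / (2 * c₀ ^ 2) := by positivity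
  have hαL : ν / (2 * c₀ ^ 2) * h ^ 2 * L ≤ ν / 2 * h ^ 2 * X := by gcongr
  have hαH : ν / (2 * c₀ ^ 2) * h ^ 2 * H ≤ H := by
    have : ν / (2 * c₀ ^ 2) * h ^ 2 ≤ 1 := by nlinarith
    nlinarith
  have e1 : 8 * h ^ 2 / ν * (m ^ 2 * Z * (1 / h) ^ 5 / (η / h ^ 2) ^ 4) ≤ ν * h ^ 2 * m / 32 := by
    calc _ = 8 * h ^ 2 * m * (Z * m * h ^ 3) / (ν * η ^ 4) := by field_simp
      _ ≤ 8 * h ^ 2 * m * (ν ^ 2 * η ^ 4 / 256) / (ν * η ^ 4) := by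
          gcongr
          have : Z * m * h ^ 3 ≤ Z * a ^ 2 * h ^ 3 := by gcongr
          linarith
      _ = _ := by field_simp; ring
  have e2 : 6 * (D / (ν * h ^ 2 * (1 / h) ^ 4) ^ 2) ≤ D / 4 := by
    calc _ = D * (24 * h ^ 4) / (4 * ν ^ 2) := by field_simp; ring
      _ ≤ D * ν ^ 2 / (4 * ν ^ 2) := by gcongr
      _ = _ := by field_simp
  -- The factor 6 is the 3 of `high_mass_le`, doubled because `1 + ν / (2 c₀²) h² ≤ 2`.
  have e3 : 6 * (4 * Z * m ^ 2 / (1 / h) ^ 3 / ν ^ 2) ≤ ν * h ^ 2 * m / 32 := by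
    calc _ = 24 * h ^ 2 * m * (Z * m * h) / ν ^ 2 := by field_simp; ring
      _ ≤ 24 * h ^ 2 * m * (ν ^ 3 / 768) / ν ^ 2 := by
          gcongr
          have : Z * m * h ≤ Z * a ^ 2 * h := by gcongr
          linarith
      _ = _ := by field_simp; ring
  have e4 : 6 * (F ^ 2 / (ν * (1 / h) ^ 4) ^ 2) ≤ 1 / 9 * (h ^ 2 * (F ^ 2 / ν)) := by
    calc _ = F ^ 2 * h ^ 2 * (54 * h ^ 6) / (9 * ν ^ 2) := by field_simp; ring
      _ ≤ F ^ 2 * h ^ 2 * ν / (9 * ν ^ 2) := by gcongr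
      _ = _ := by field_simp
  -- The errors proportional to `m` are returned to the dissipation through `m ≤ 2 D + 2 L ≤ 2 D + 2
  -- X`. With `e2` this uses all of `D / 2`, and `5/8 - 1/8 = 1/2` of the viscous term remains for
  -- the decay factor.
  have e5 : ν * h ^ 2 * m / 16 ≤ D / 4 + 1 / 8 * (ν * h ^ 2 * X) := by
    have : ν * h ^ 2 * m ≤ ν * h ^ 2 * (2 * D + 2 * X) := by
      gcongr
      linarith
    have h7 : ν * h ^ 2 * D ≤ 2 * D := by gcongr
    linarith
  linarith

/-! ### Discrete Gronwall inequalities. -/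

lemma discrete_gronwall {y : ℕ → ℝ} {dt g H : ℝ} (hdt : 0 < dt) (hg : 0 ≤ g) (hH : 0 ≤ H)
    (hy : ∀ n, 0 ≤ y n) (hstep : ∀ n, y (n + 1) ≤ y n * (1 + dt * (g * y n)) + dt * H)
    (j m : ℕ) :
    y (j + m) ≤ (y j + m * dt * H) * Real.exp (g * (dt * ∑ n ∈ Finset.range m, y (j + n))) := by
  induction m with
  | zero => simp
  | succ m ih =>
    set S := g * (dt * ∑ n ∈ Finset.range m, y (j + n))
    have hS : g * (dt * ∑ n ∈ Finset.range (m + 1), y (j + n)) = S + dt * (g * y (j + m)) := by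
      rw [Finset.sum_range_succ]; ring
    have hS0 : 0 ≤ S := mul_nonneg hg (mul_nonneg hdt.le (Finset.sum_nonneg fun n _ => hy _))
    have hx0 : 0 ≤ dt * (g * y (j + m)) := mul_nonneg hdt.le (mul_nonneg hg (hy _))
    rw [hS]
    set x := dt * (g * y (j + m))
    have hC : 0 ≤ y j + m * dt * H := add_nonneg (hy j) (by positivity)
    have h1 : 1 + x ≤ Real.exp x := by linarith [Real.add_one_le_exp x]
    have h2 : 1 ≤ Real.exp (S + x) := Real.one_le_exp (by linarith)
    calc y (j + (m + 1)) ≤ y (j + m) * (1 + x) + dt * H := hstep (j + m)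
      _ ≤ (y j + m * dt * H) * Real.exp S * Real.exp x + dt * H * Real.exp (S + x) := by
          refine add_le_add (mul_le_mul ih h1 (by linarith) (by positivity)) ?_
          exact le_mul_of_one_le_right (by positivity) h2
      _ = _ := by rw [mul_assoc, ← Real.exp_add]; push_cast; ring

/-- The window has length at least 1, so some `y (i + q)` in it is at most `Q`. Gronwall started
there forgets the initial value. -/
lemma uniform_gronwall {y : ℕ → ℝ} {dt g H Q : ℝ} (hdt : 0 < dt) (hg : 0 ≤ g)
    (hH : 0 ≤ H) (hy : ∀ n, 0 ≤ y n)
    (hstep : ∀ n, y (n + 1) ≤ y n * (1 + dt * (g * y n)) + dt * H) {i p : ℕ}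
    (hp1 : 1 ≤ p * dt) (hp2 : p * dt ≤ 2)
    (hsum : dt * ∑ n ∈ Finset.range p, y (i + n) ≤ Q) :
    y (i + p) ≤ (Q + 2 * H) * Real.exp (g * Q) := by
  have hQ : 0 ≤ Q := le_trans (mul_nonneg hdt.le (Finset.sum_nonneg fun n _ => hy _)) hsum
  have hp : 0 < p := by
    rcases Nat.eq_zero_or_pos p with h | h
    · subst h; norm_num at hp1
    · exact h
  obtain ⟨q, hq, hyq⟩ : ∃ q ∈ Finset.range p, y (i + q) ≤ Q := by
    refine Finset.exists_le_of_sum_le (g := fun _ => Q) ⟨0, Finset.mem_range.2 hp⟩ ?_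
    rw [Finset.sum_const, Finset.card_range, nsmul_eq_mul]
    have : dt * ∑ n ∈ Finset.range p, y (i + n) ≤ dt * (p * Q) := by nlinarith
    exact le_of_mul_le_mul_left this hdt
  rw [Finset.mem_range] at hq
  have h := discrete_gronwall hdt hg hH hy hstep (i + q) (p - q)
  rw [show i + q + (p - q) = i + p by omega] at h
  refine h.trans ?_
  have hsub : ∑ n ∈ Finset.range (p - q), y (i + q + n) ≤ ∑ n ∈ Finset.range p, y (i + n) := by
    have := Finset.sum_range_add_sum_Ico (fun n => y (i + n)) hq.le
    rw [Finset.sum_Ico_eq_sum_range] at this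
    simp_rw [← add_assoc] at this
    have h0 : 0 ≤ ∑ n ∈ Finset.range q, y (i + n) := Finset.sum_nonneg fun n _ => hy _
    linarith
  have hpq : ((p - q : ℕ) : ℝ) * dt ≤ 2 := by
    refine le_trans (mul_le_mul_of_nonneg_right ?_ hdt.le) hp2
    exact_mod_cast Nat.sub_le p q
  have h0 := hy (i + q)
  gcongr
  exact (mul_le_mul_of_nonneg_left hsub hdt.le).trans hsum

/-! ### Smallness of the time step. -/

/-- Smallness of the time step `h²`. -/
structure IsSmallStep (Z ν F a M h : ℝ) : Prop where
  pos : 0 < h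
  le_one : h ≤ 1
  cutoff : ∃ η : ℝ, 0 < η ∧ η * (Z * a ^ 2) ≤ ν / 16 ∧ 256 * (Z * a ^ 2) * h ^ 3 ≤ ν ^ 2 * η ^ 4
  flux : 768 * (Z * a ^ 2) * h ≤ ν ^ 3
  two : ν * h ^ 2 ≤ 2
  four : 24 * h ^ 4 ≤ ν ^ 2
  six : 54 * h ^ 6 ≤ ν
  velocity : h ^ 2 * (√(Z / √(ν * h ^ 2)) * (M + h ^ 2 * F) + 2 * Z * M ^ 2 / ν) ^ 2 ≤ ν / 2

/-- The parameter `η` is fixed first, from the data alone. Every condition then compares a quantity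
vanishing as `h → 0` with a positive constant; for the velocity, `h² (Z / √(ν h²)) = h Z / √ν`. -/
lemma exists_isSmallStep (Z ν F a M : ℝ) (hZ : 0 ≤ Z) (hν : 0 < ν) :
    ∃ ε : ℝ, 0 < ε ∧ ∀ dt, 0 < dt → dt ≤ ε → IsSmallStep Z ν F a M √dt := by
  have key : ∀ (u : ℝ → ℝ) (b : ℝ), Continuous u → u 0 = 0 → 0 < b →
      ∀ᶠ h in nhdsWithin (0 : ℝ) (Set.Ioi 0), u h ≤ b := by
    intro u b hu h0 hb
    have ht : Filter.Tendsto u (nhdsWithin 0 (Set.Ioi 0)) (nhds 0) := by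
      simpa [h0] using (hu.tendsto 0).mono_left nhdsWithin_le_nhds
    filter_upwards [ht.eventually (gt_mem_nhds hb)] with h hh using hh.le
  set η := ν / (16 * (Z * a ^ 2 + 1)) with hη
  have hη0 : 0 < η := by positivity
  have hηa : η * (Z * a ^ 2) ≤ ν / 16 := by
    rw [hη, div_mul_eq_mul_div, div_le_div_iff₀ (by positivity) (by norm_num)]
    nlinarith
  have hν0 : 0 < √ν := Real.sqrt_pos.2 hν
  have hev : ∀ᶠ h in nhdsWithin (0 : ℝ) (Set.Ioi 0), IsSmallStep Z ν F a M h := by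
    filter_upwards [self_mem_nhdsWithin,
      key (fun h => h) 1 (by fun_prop) (by simp) one_pos,
      key (fun h => 256 * (Z * a ^ 2) * h ^ 3) (ν ^ 2 * η ^ 4) (by fun_prop) (by simp)
        (by positivity),
      key (fun h => 768 * (Z * a ^ 2) * h) (ν ^ 3) (by fun_prop) (by simp) (by positivity),
      key (fun h => ν * h ^ 2) 2 (by fun_prop) (by simp) (by positivity),
      key (fun h => 24 * h ^ 4) (ν ^ 2) (by fun_prop) (by simp) (by positivity),
      key (fun h => 54 * h ^ 6) ν (by fun_prop) (by simp) (by positivity),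
      key (fun h => 2 * (h * (Z / √ν)) * (M + h ^ 2 * F) ^ 2 + 2 * h ^ 2 * (2 * Z * M ^ 2 / ν) ^ 2)
        (ν / 2) (by fun_prop) (by simp) (by positivity)] with h h0 h1 h2 h3 h4 h5 h6 h7
    have hpos : 0 < h := h0
    refine ⟨h0, h1, ⟨η, hη0, hηa, h2⟩, h3, h4, h5, h6, le_trans ?_ h7⟩
    have hs : √(ν * h ^ 2) = √ν * h := by rw [Real.sqrt_mul hν.le, Real.sqrt_sq hpos.le]
    have hr : √(Z / √(ν * h ^ 2)) ^ 2 = Z / (√ν * h) := by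
      rw [hs, Real.sq_sqrt (by positivity)]
    set r := √(Z / √(ν * h ^ 2))
    set A := M + h ^ 2 * F
    set C := 2 * Z * M ^ 2 / ν
    calc h ^ 2 * (r * A + C) ^ 2 ≤ h ^ 2 * (2 * r ^ 2 * A ^ 2 + 2 * C ^ 2) := by
          gcongr
          nlinarith [sq_nonneg (r * A - C)]
      _ = _ := by
          rw [hr]
          field_simp
  rw [eventually_nhdsWithin_iff, Metric.eventually_nhds_iff] at hev
  obtain ⟨δ, hδ, hball⟩ := hev
  refine ⟨(δ / 2) ^ 2, by positivity, fun dt hdt hle => ?_⟩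
  have hs : 0 < √dt := Real.sqrt_pos.2 hdt
  refine hball ?_ hs
  rw [Real.dist_eq, sub_zero, abs_of_pos hs]
  have : √dt ≤ δ / 2 := (Real.sqrt_le_left (by positivity)).2 hle
  linarith

lemma le_of_contraction {A A' K a α r : ℝ} (hα : 0 ≤ α) (hr : 0 < r)
    (hA : A ≤ r⁻¹ * a + K * (1 - r⁻¹)) (hstep : (1 + α) * A' ≤ A + α * K) :
    A' ≤ (r * (1 + α))⁻¹ * a + K * (1 - (r * (1 + α))⁻¹) := by
  have h1 : 0 < 1 + α := by linarith
  have h2 : A' ≤ (r⁻¹ * a + K * (1 - r⁻¹) + α * K) / (1 + α) := by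
    rw [le_div_iff₀ h1]
    linarith
  refine h2.trans (le_of_eq ?_)
  field_simp
  ring

/-! ### Bounds along the whole sequence of iterates. -/

section Orbit

variable {N : ℕ} {ν h F a c₀ Z : ℝ} {c f : ℕ → ℤ × ℤ → ℂ}

/-- An upper bound for the mass of all iterates. -/
def massBound (a ν F c₀ : ℝ) : ℝ := √(a ^ 2 + 2 * c₀ ^ 4 / ν ^ 2 * F ^ 2)

lemma interpolation_le_massBound {a ν F c₀ r : ℝ} (hr : 1 ≤ r) :
    r⁻¹ * a ^ 2 + 2 * c₀ ^ 4 / ν ^ 2 * F ^ 2 * (1 - r⁻¹) ≤ massBound a ν F c₀ ^ 2 := by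
  have h0 : 0 < r⁻¹ := by positivity
  have h1 : r⁻¹ ≤ 1 := inv_le_one_of_one_le₀ hr
  have hK : 0 ≤ 2 * c₀ ^ 4 / ν ^ 2 * F ^ 2 := by positivity
  rw [massBound, Real.sq_sqrt (by positivity)]
  nlinarith [sq_nonneg a]

lemma velBound_of_isSmallStep {B : Finset (ℤ × ℤ)} {M : ℝ} {v g w : ℤ × ℤ → ℂ}
    (hs : IsStep B ν (h ^ 2) v g w) (hsm : IsSmallStep Z ν F a M h) (hν : 0 < ν) (hF : 0 ≤ F)
    (hg : mass B g ≤ F ^ 2) (hZ : ∑ k ∈ B, 1 / freqRt k ^ 5 ≤ Z) (hM : 0 ≤ M)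
    (hv : mass B v ≤ M ^ 2) : h ^ 2 * velBound B w ^ 2 ≤ ν / 2 := by
  have hpos := hsm.pos
  refine le_trans ?_ hsm.velocity
  have h1 := hs.velBound_le hν (by positivity) hF hg hM hv hZ
  have h0 := velBound_nonneg B w
  gcongr

/-- Strong induction: the mass of iterate `n` bounds the velocity of iterate `n + 1`, which makes
the energy inequality available for the step to `n + 2`. Only the step from 0 to 1 needs
`mass_le_of_small`. -/
lemma mass_orbit_le (hstep : ∀ n, IsStep (box N) ν (h ^ 2) (c n) (f n) (c (n + 1)))
    (hsm : IsSmallStep Z ν F a (massBound a ν F c₀) h) (hν : 0 < ν) (hF : 0 ≤ F)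
    (hf : ∀ n, mass (box N) (f n) ≤ F ^ 2) (hZ : ∑ k ∈ box N, 1 / freqRt k ^ 5 ≤ Z)
    (hc₀ : 1 ≤ c₀) (ha : mass (box N) (c 0) ≤ a ^ 2) (n : ℕ) :
    mass (box N) (c n) ≤ ((1 + ν / (2 * c₀ ^ 2) * h ^ 2) ^ n)⁻¹ * a ^ 2 +
      2 * c₀ ^ 4 / ν ^ 2 * F ^ 2 * (1 - ((1 + ν / (2 * c₀ ^ 2) * h ^ 2) ^ n)⁻¹) := by
  have hpos := hsm.pos
  set α := ν / (2 * c₀ ^ 2) * h ^ 2 with hα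
  have hα0 : 0 ≤ α := by positivity
  have hβ : h ^ 2 * (F ^ 2 / ν) ≤ α * (2 * c₀ ^ 4 / ν ^ 2 * F ^ 2) := by
    have : α * (2 * c₀ ^ 4 / ν ^ 2 * F ^ 2) = h ^ 2 * (F ^ 2 / ν) * c₀ ^ 2 := by
      rw [hα]; field_simp
    rw [this]
    exact le_mul_of_one_le_right (by positivity) (one_le_pow₀ hc₀)
  have hαX : ∀ w, α * mass (box N) w ≤ ν / 2 * h ^ 2 * enstrophy (box N) w := by
    intro w
    have h1 := mass_le_enstrophy (hstep 0).ne_zero w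
    have h2 := mass_nonneg (box N) w
    have : α ≤ ν / 2 * h ^ 2 := by
      rw [hα]
      gcongr
      nlinarith
    gcongr
  have hbound : ∀ n, mass (box N) (c n) ≤
      ((1 + α) ^ n)⁻¹ * a ^ 2 + 2 * c₀ ^ 4 / ν ^ 2 * F ^ 2 * (1 - ((1 + α) ^ n)⁻¹) →
      mass (box N) (c n) ≤ massBound a ν F c₀ ^ 2 := fun n hn =>
    hn.trans (interpolation_le_massBound (one_le_pow₀ (by linarith)))
  induction n using Nat.strong_induction_on with
  | _ n ih =>
    match n, ih with
    | 0, _ => simpa using ha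
    | 1, _ =>
      obtain ⟨η, hη, h1, h2⟩ := hsm.cutoff
      have := (hstep 0).mass_le_of_small hν hpos hF (hf 0) hZ hc₀ ha hη h1 h2 hsm.flux hsm.two
        hsm.four hsm.six
      have h3 := le_of_contraction (A := mass (box N) (c 0)) (A' := mass (box N) (c 1)) (a := a ^ 2)
        (K := 2 * c₀ ^ 4 / ν ^ 2 * F ^ 2) (r := 1) hα0 one_pos
        (by simpa using ha) (by linarith)
      simpa using h3
    | n + 2, ih =>
      have hU := velBound_of_isSmallStep (hstep n) hsm hν hF (hf n) hZ (Real.sqrt_nonneg _)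
        (hbound n (ih n (by omega)))
      have h1 := (hstep (n + 1)).mass_add_enstrophy_le hν (by positivity) hF (hf (n + 1)) hU
      have h2 := hαX (c (n + 1 + 1))
      rw [pow_succ]
      exact le_of_contraction hα0 (by positivity) (ih (n + 1) (by omega)) (by linarith)

lemma mass_orbit_le_massBound
    (hstep : ∀ n, IsStep (box N) ν (h ^ 2) (c n) (f n) (c (n + 1)))
    (hsm : IsSmallStep Z ν F a (massBound a ν F c₀) h) (hν : 0 < ν) (hF : 0 ≤ F)
    (hf : ∀ n, mass (box N) (f n) ≤ F ^ 2) (hZ : ∑ k ∈ box N, 1 / freqRt k ^ 5 ≤ Z)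
    (hc₀ : 1 ≤ c₀) (ha : mass (box N) (c 0) ≤ a ^ 2) (n : ℕ) :
    mass (box N) (c n) ≤ massBound a ν F c₀ ^ 2 := by
  refine (mass_orbit_le hstep hsm hν hF hf hZ hc₀ ha n).trans (interpolation_le_massBound ?_)
  have hpos := hsm.pos
  exact one_le_pow₀ (le_add_of_nonneg_right (by positivity))

/-- The sum starts at index `i + 2` because the energy inequality is applied only to steps whose
starting iterate has already been smoothed. -/
lemma sum_enstrophy_orbit_le
    (hstep : ∀ n, IsStep (box N) ν (h ^ 2) (c n) (f n) (c (n + 1)))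
    (hsm : IsSmallStep Z ν F a (massBound a ν F c₀) h) (hν : 0 < ν) (hF : 0 ≤ F)
    (hf : ∀ n, mass (box N) (f n) ≤ F ^ 2) (hZ : ∑ k ∈ box N, 1 / freqRt k ^ 5 ≤ Z)
    (hc₀ : 1 ≤ c₀) (ha : mass (box N) (c 0) ≤ a ^ 2) (i p : ℕ) :
    ν / 2 * h ^ 2 * ∑ n ∈ Finset.range p, enstrophy (box N) (c (i + 2 + n)) ≤
      mass (box N) (c (i + 1)) + p * h ^ 2 * (F ^ 2 / ν) := by
  have hpos := hsm.pos
  suffices hs : mass (box N) (c (i + 1 + p)) +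
      ν / 2 * h ^ 2 * ∑ n ∈ Finset.range p, enstrophy (box N) (c (i + 2 + n)) ≤
      mass (box N) (c (i + 1)) + p * h ^ 2 * (F ^ 2 / ν) by
    linarith [mass_nonneg (box N) (c (i + 1 + p))]
  induction p with
  | zero => simp
  | succ p ih =>
    have hU := velBound_of_isSmallStep (hstep (i + p)) hsm hν hF (hf _) hZ (Real.sqrt_nonneg _)
      (mass_orbit_le_massBound hstep hsm hν hF hf hZ hc₀ ha (i + p))
    have h1 := (hstep (i + p + 1)).mass_add_enstrophy_le hν (by positivity) hF (hf _) hU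
    rw [Finset.sum_range_succ, show i + 1 + (p + 1) = i + p + 1 + 1 by omega,
      show i + 2 + p = i + p + 1 + 1 by omega]
    rw [show i + 1 + p = i + p + 1 by omega] at ih
    push_cast
    linarith

/-- The bound for the dissipation over a unit time window after the transient. -/
def windowBound (ν F c₀ : ℝ) : ℝ :=
  2 / ν * (1 + 2 * c₀ ^ 4 / ν ^ 2 * F ^ 2 + 2 * (F ^ 2 / ν))

lemma enstrophy_orbit_le
    (hstep : ∀ n, IsStep (box N) ν (h ^ 2) (c n) (f n) (c (n + 1)))
    (hsm : IsSmallStep Z ν F a (massBound a ν F c₀) h) (hν : 0 < ν) (hF : 0 ≤ F)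
    (hf : ∀ n, mass (box N) (f n) ≤ F ^ 2) (hZ : ∑ k ∈ box N, 1 / freqRt k ^ 5 ≤ Z)
    (hZ0 : 0 ≤ Z) (hc₀ : 1 ≤ c₀) (ha : mass (box N) (c 0) ≤ a ^ 2) {n : ℕ}
    (hn : 2 * c₀ ^ 2 * a ^ 2 / ν + 5 ≤ n * h ^ 2) :
    enstrophy (box N) (c n) ≤ (windowBound ν F c₀ + 2 * (F ^ 2 / ν)) *
      Real.exp (Z / ν * windowBound ν F c₀) := by
  have hpos := hsm.pos
  have hdt : 0 < h ^ 2 := by positivity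
  have hdt1 : h ^ 2 ≤ 1 := pow_le_one₀ hpos.le hsm.le_one
  -- The window has length between 1 and 2. The 5 in `hn` covers it, together with the two extra
  -- steps that precede it.
  set p := ⌈1 / h ^ 2⌉₊ with hp
  have hp1 : 1 ≤ p * h ^ 2 := by
    rw [← div_le_iff₀ hdt]
    exact Nat.le_ceil _
  have hp2 : p * h ^ 2 ≤ 1 + h ^ 2 := by
    have := (Nat.ceil_lt_add_one (by positivity : 0 ≤ 1 / h ^ 2)).le
    calc (p : ℝ) * h ^ 2 ≤ (1 / h ^ 2 + 1) * h ^ 2 := by gcongr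
      _ = _ := by field_simp
  have ht0 : 0 ≤ 2 * c₀ ^ 2 * a ^ 2 / ν := by positivity
  have hnp : p + 2 ≤ n := by
    have : ((p : ℝ) + 2) * h ^ 2 ≤ n * h ^ 2 := by linarith
    exact_mod_cast le_of_mul_le_mul_right this hdt
  obtain ⟨i, rfl⟩ : ∃ i, n = i + 2 + p := ⟨n - p - 2, by omega⟩
  have hmass : mass (box N) (c (i + 1)) ≤ 1 + 2 * c₀ ^ 4 / ν ^ 2 * F ^ 2 := by
    refine (mass_orbit_le hstep hsm hν hF hf hZ hc₀ ha (i + 1)).trans ?_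
    set α := ν / (2 * c₀ ^ 2) * h ^ 2 with hα
    have hα0 : 0 ≤ α := by positivity
    -- Bernoulli's inequality: at time `2 c₀² a² / ν` the initial mass has decayed below 1, so the
    -- later bounds no longer see `a`.
    have hr : a ^ 2 ≤ (1 + α) ^ (i + 1) := by
      refine le_trans ?_ (one_add_mul_le_pow (by linarith) (i + 1))
      have h1 : 2 * c₀ ^ 2 * a ^ 2 / ν ≤ ((i + 1 : ℕ) : ℝ) * h ^ 2 := by
        push_cast at hn ⊢
        linarith
      have h2 : ν / (2 * c₀ ^ 2) * (2 * c₀ ^ 2 * a ^ 2 / ν) ≤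
          ν / (2 * c₀ ^ 2) * (((i + 1 : ℕ) : ℝ) * h ^ 2) := by gcongr
      have h3 : ν / (2 * c₀ ^ 2) * (2 * c₀ ^ 2 * a ^ 2 / ν) = a ^ 2 := by field_simp
      have h4 : ν / (2 * c₀ ^ 2) * (((i + 1 : ℕ) : ℝ) * h ^ 2) = ((i + 1 : ℕ) : ℝ) * α := by
        rw [hα]; ring
      linarith
    have hr0 : 0 < (1 + α) ^ (i + 1) := by positivity
    have h1 : ((1 + α) ^ (i + 1))⁻¹ * a ^ 2 ≤ 1 := by
      rw [inv_mul_le_iff₀ hr0]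
      linarith
    have h2 : 0 < ((1 + α) ^ (i + 1))⁻¹ := by positivity
    have hK : 0 ≤ 2 * c₀ ^ 4 / ν ^ 2 * F ^ 2 := by positivity
    nlinarith
  have hsum := sum_enstrophy_orbit_le hstep hsm hν hF hf hZ hc₀ ha i p
  refine uniform_gronwall (y := fun n => enstrophy (box N) (c n)) hdt (by positivity)
    (by positivity) (fun n => enstrophy_nonneg _ _)
    (fun n => (hstep n).enstrophy_le hν hdt hF (hf n) hZ) hp1 (by linarith) ?_
  have h2 : (p : ℝ) * h ^ 2 * (F ^ 2 / ν) ≤ 2 * (F ^ 2 / ν) := by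
    gcongr
    linarith
  have h3 : ν / 2 * (h ^ 2 * ∑ n ∈ Finset.range p, enstrophy (box N) (c (i + 2 + n))) ≤
      ν / 2 * windowBound ν F c₀ := by
    have : ν / 2 * windowBound ν F c₀ = 1 + 2 * c₀ ^ 4 / ν ^ 2 * F ^ 2 + 2 * (F ^ 2 / ν) := by
      unfold windowBound
      field_simp
    rw [this]
    linarith
  exact le_of_mul_le_mul_left h3 (by positivity)

end Orbit

/-! ### Trigonometric polynomials and their Fourier coefficients. -/

/-- The Fourier character `exp(i k·x)`. -/
def char (k : ℤ × ℤ) (x : ℝ × ℝ) : ℂ :=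
  Complex.exp (Complex.I * (((k.1 : ℝ) * x.1 + (k.2 : ℝ) * x.2 : ℝ) : ℂ))

lemma char_zero (x : ℝ × ℝ) : char 0 x = 1 := by simp [char]

lemma char_add (j k : ℤ × ℤ) (x : ℝ × ℝ) : char (j + k) x = char j x * char k x := by
  rw [char, char, char, ← Complex.exp_add]
  congr 1
  simp only [Prod.fst_add, Prod.snd_add]
  push_cast
  ring

lemma star_char (k : ℤ × ℤ) (x : ℝ × ℝ) : star (char k x) = char (-k) x := by
  rw [char, char, Complex.star_def, ← Complex.exp_conj, map_mul, Complex.conj_I,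
    Complex.conj_ofReal]
  congr 1
  simp only [Prod.fst_neg, Prod.snd_neg]
  push_cast
  ring

lemma continuous_char (k : ℤ × ℤ) : Continuous (char k) := by
  unfold char
  fun_prop

lemma char_eq (k : ℤ × ℤ) (x : ℝ × ℝ) : char k x =
    (Real.cos ((k.1 : ℝ) * x.1 + (k.2 : ℝ) * x.2) : ℂ) +
      (Real.sin ((k.1 : ℝ) * x.1 + (k.2 : ℝ) * x.2) : ℂ) * Complex.I := by
  rw [char, mul_comm, Complex.exp_mul_I, Complex.ofReal_cos, Complex.ofReal_sin]

lemma integral_exp_int (n : ℤ) : ∫ t in Set.Ioo 0 (2 * Real.pi), Complex.exp (Complex.I * n * t) =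
    if n = 0 then ((2 * Real.pi : ℝ) : ℂ) else 0 := by
  rw [← integral_Ioc_eq_integral_Ioo, ← intervalIntegral.integral_of_le (by positivity)]
  split_ifs with h
  · simp [h]
  · rw [integral_exp_mul_complex (by simp [h])]
    have : Complex.exp (Complex.I * n * ((2 * Real.pi : ℝ) : ℂ)) = 1 := by
      rw [Complex.exp_eq_one_iff]
      exact ⟨n, by push_cast; ring⟩
    rw [this]
    simp

lemma integral_char (k : ℤ × ℤ) :
    ∫ x in cell, char k x = if k = 0 then ((4 * Real.pi ^ 2 : ℝ) : ℂ) else 0 := by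
  have h : ∀ x : ℝ × ℝ, char k x = Complex.exp (Complex.I * k.1 * x.1) *
      Complex.exp (Complex.I * k.2 * x.2) := by
    intro x
    rw [char, ← Complex.exp_add]
    congr 1
    push_cast
    ring
  simp_rw [h]
  rw [cell, Measure.volume_eq_prod, setIntegral_prod_mul
    (fun t : ℝ => Complex.exp (Complex.I * k.1 * t)) (fun t : ℝ => Complex.exp (Complex.I * k.2 * t)),
    integral_exp_int, integral_exp_int]
  by_cases h1 : k.1 = 0 <;> by_cases h2 : k.2 = 0 <;> simp [h1, h2, Prod.ext_iff]
  ring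

lemma _root_.Continuous.integrable_cell {E : Type*} [NormedAddCommGroup E] {g : ℝ × ℝ → E}
    (hg : Continuous g) : Integrable g (volume.restrict cell) := by
  have hK : IsCompact (Set.Icc 0 (2 * Real.pi) ×ˢ Set.Icc 0 (2 * Real.pi)) :=
    isCompact_Icc.prod isCompact_Icc
  exact (hg.continuousOn.integrableOn_compact hK).mono_set
    (Set.prod_mono Set.Ioo_subset_Icc_self Set.Ioo_subset_Icc_self)

/-- The Fourier coefficients of a function on the cell. -/
def fcoeff (φ : ℝ × ℝ → ℝ) (k : ℤ × ℤ) : ℂ :=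
  ((4 * Real.pi ^ 2 : ℝ) : ℂ)⁻¹ * ∫ x in cell, (φ x : ℂ) * char (-k) x

lemma four_pi_sq_ne_zero : ((4 * Real.pi ^ 2 : ℝ) : ℂ) ≠ 0 := by
  simp [Real.pi_ne_zero]

lemma fcoeff_neg (φ : ℝ × ℝ → ℝ) (k : ℤ × ℤ) : fcoeff φ (-k) = star (fcoeff φ k) := by
  rw [fcoeff, fcoeff, star_mul', Complex.star_def, map_inv₀, Complex.conj_ofReal, ← integral_conj]
  congr 1
  refine integral_congr_ae (Filter.Eventually.of_forall fun x => ?_)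
  simp only
  rw [map_mul, Complex.conj_ofReal, ← Complex.star_def, star_char]

/-- `φ` is the trigonometric sum with coefficients `c`, supported in `box N`. -/
structure IsTrigSum (N : ℕ) (c : ℤ × ℤ → ℂ) (φ : ℝ × ℝ → ℝ) : Prop where
  off : ∀ k, k ∉ box N → c k = 0
  eq : ∀ x, (φ x : ℂ) = ∑ k ∈ box N, c k * char k x

lemma exists_isTrigSum {N : ℕ} {φ : ℝ × ℝ → ℝ} (hφ : φ ∈ trigPoly N) :
    ∃ c, IsTrigSum N c φ := by
  induction hφ using Submodule.span_induction with
  | zero => exact ⟨0, ⟨fun _ _ => rfl, fun x => by simp⟩⟩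
  | add φ χ _ _ h1 h2 =>
    obtain ⟨c, hc⟩ := h1
    obtain ⟨d, hd⟩ := h2
    refine ⟨c + d, fun k hk => by simp [hc.off k hk, hd.off k hk], fun x => ?_⟩
    simp [hc.eq, hd.eq, add_mul, Finset.sum_add_distrib]
  | smul r φ _ h1 =>
    obtain ⟨c, hc⟩ := h1
    refine ⟨fun k => r * c k, fun k hk => by simp [hc.off k hk], fun x => ?_⟩
    simp [hc.eq, mul_assoc, Finset.mul_sum]
  | mem g hg =>
    obtain ⟨k, l, hk, hl, h0, hg⟩ := hg
    have hmem : (k, l) ∈ box N := mem_box.2 ⟨by simpa [Prod.ext_iff, or_iff_not_imp_left] using h0, hk, hl⟩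
    have hmem' := neg_mem_box hmem
    have hsum : ∀ (a b : ℂ) (x : ℝ × ℝ), ∑ m ∈ box N,
        ((if m = (k, l) then a else 0) + if m = -(k, l) then b else 0) * char m x =
        a * char (k, l) x + b * char (-(k, l)) x := by
      intro a b x
      simp only [add_mul, ite_mul, zero_mul, Finset.sum_add_distrib, Finset.sum_ite_eq', hmem, hmem',
        if_true]
    have hoff : ∀ (a b : ℂ) (m : ℤ × ℤ), m ∉ box N →
        ((if m = (k, l) then a else 0) + if m = -(k, l) then b else 0) = 0 := by
      intro a b m hm
      have h1 : m ≠ (k, l) := fun h => hm (h ▸ hmem)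
      have h2 : m ≠ -(k, l) := fun h => hm (h ▸ hmem')
      rw [if_neg h1, if_neg h2, add_zero]
    have hneg : ∀ x, char (-(k, l)) x =
        (Real.cos ((k : ℝ) * x.1 + (l : ℝ) * x.2) : ℂ) -
      (Real.sin ((k : ℝ) * x.1 + (l : ℝ) * x.2) : ℂ) * Complex.I := by
      intro x
      rw [← star_char, char_eq, star_add, star_mul', Complex.star_def, Complex.conj_I,
        Complex.conj_ofReal, Complex.conj_ofReal]
      ring
    rcases hg with rfl | rfl
    · refine ⟨_, hoff (1 / 2) (1 / 2), fun x => ?_⟩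
      rw [hsum, char_eq, hneg]
      ring
    · refine ⟨_, hoff (-Complex.I / 2) (Complex.I / 2), fun x => ?_⟩
      rw [hsum, char_eq, hneg]
      linear_combination (Real.sin ((k : ℝ) * x.1 + (l : ℝ) * x.2) : ℂ) * Complex.I_sq

namespace IsTrigSum

variable {N : ℕ} {c d : ℤ × ℤ → ℂ} {φ χ : ℝ × ℝ → ℝ}

lemma re_eq (h : IsTrigSum N c φ) (x : ℝ × ℝ) : φ x = (∑ k ∈ box N, c k * char k x).re := by
  rw [← h.eq, Complex.ofReal_re]

lemma continuous (h : IsTrigSum N c φ) : Continuous φ := by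
  have : φ = fun x => (∑ k ∈ box N, c k * char k x).re := funext h.re_eq
  rw [this]
  exact Complex.continuous_re.comp
    (continuous_finsetSum _ fun k _ => continuous_const.mul (continuous_char k))

lemma integral_mul (h : IsTrigSum N c φ) {g : ℝ × ℝ → ℂ} (hg : Continuous g) :
    ∫ x in cell, (φ x : ℂ) * g x = ∑ k ∈ box N, c k * ∫ x in cell, char k x * g x := by
  simp_rw [h.eq, Finset.sum_mul]
  rw [integral_finsetSum]
  · refine Finset.sum_congr rfl fun k _ => ?_
    rw [← integral_const_mul]
    simp_rw [mul_assoc]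
  · intro k _
    exact ((continuous_const.mul (continuous_char k)).mul hg).integrable_cell

lemma fcoeff_eq (h : IsTrigSum N c φ) : fcoeff φ = c := by
  funext m
  rw [fcoeff, h.integral_mul (continuous_char _)]
  have : ∀ k, ∫ x in cell, char k x * char (-m) x =
      if k = m then ((4 * Real.pi ^ 2 : ℝ) : ℂ) else 0 := by
    intro k
    simp_rw [← char_add, integral_char, ← sub_eq_add_neg, sub_eq_zero]
  simp_rw [this]
  rw [inv_mul_eq_iff_eq_mul₀ four_pi_sq_ne_zero]
  simp only [mul_ite, mul_zero, Finset.sum_ite_eq']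
  split_ifs with hm
  · ring
  · rw [h.off m hm, mul_zero]

lemma fcoeff_mul (h : IsTrigSum N c φ) (hχ : Continuous χ) (m : ℤ × ℤ) :
    fcoeff (fun x => φ x * χ x) m = ∑ j ∈ box N, c j * fcoeff χ (m - j) := by
  have hg : Continuous fun x => (χ x : ℂ) * char (-m) x :=
    (Complex.continuous_ofReal.comp hχ).mul (continuous_char _)
  have h1 := h.integral_mul hg
  rw [fcoeff]
  simp_rw [Complex.ofReal_mul, mul_assoc]
  rw [h1, Finset.mul_sum]
  refine Finset.sum_congr rfl fun j _ => ?_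
  have hI : ∫ x in cell, char j x * ((χ x : ℂ) * char (-m) x) =
      ∫ x in cell, (χ x : ℂ) * char (-(m - j)) x := by
    refine integral_congr_ae (Filter.Eventually.of_forall fun x => ?_)
    simp only
    rw [show -(m - j) = j + -m by abel, char_add]
    ring
  rw [fcoeff, hI, ← Complex.ofReal_mul]
  exact mul_left_comm (_ : ℂ) _ _

/-- Parseval, read off from the zeroth coefficient of `φ * φ`. -/
lemma integral_sq (h : IsTrigSum N c φ) :
    ∫ x in cell, φ x ^ 2 = 4 * Real.pi ^ 2 * mass (box N) c := by
  have h1 := h.fcoeff_mul h.continuous 0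
  rw [fcoeff, inv_mul_eq_iff_eq_mul₀ four_pi_sq_ne_zero] at h1
  have h2 : ∑ j ∈ box N, c j * fcoeff φ (0 - j) = (mass (box N) c : ℂ) := by
    rw [mass, Complex.ofReal_sum]
    refine Finset.sum_congr rfl fun j _ => ?_
    rw [zero_sub, fcoeff_neg, h.fcoeff_eq, Complex.star_def, Complex.mul_conj,
      Complex.normSq_eq_norm_sq]
  rw [h2] at h1
  have h3 : ∫ x in cell, ((φ x * φ x : ℝ) : ℂ) * char (-0) x =
      ((∫ x in cell, φ x ^ 2 : ℝ) : ℂ) := by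
    rw [← integral_complex_ofReal]
    refine integral_congr_ae (Filter.Eventually.of_forall fun x => ?_)
    simp only
    rw [neg_zero, char_zero, mul_one, sq]
  rw [h3] at h1
  exact_mod_cast h1

lemma of_hasDerivAt {u : ℝ → ℝ} {u' : ℂ} {t : ℝ} (hu : HasDerivAt (fun s => (u s : ℂ)) u' t) :
    ((deriv u t : ℝ) : ℂ) = u' := by
  have hre : HasDerivAt u u'.re t := by
    simpa [Function.comp_def] using Complex.reCLM.hasFDerivAt.comp_hasDerivAt t hu
  have him : HasDerivAt (fun _ : ℝ => (0 : ℝ)) u'.im t := by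
    simpa [Function.comp_def] using Complex.imCLM.hasFDerivAt.comp_hasDerivAt t hu
  rw [hre.deriv]
  exact Complex.ext (by simp) (by simpa using (hasDerivAt_const t (0 : ℝ)).unique him)

lemma dx (h : IsTrigSum N c φ) :
    IsTrigSum N (fun k => Complex.I * (k.1 : ℝ) * c k) (GalerkinNSE.dx φ) := by
  refine ⟨fun k hk => by simp [h.off k hk], fun x => of_hasDerivAt ?_⟩
  simp_rw [h.eq]
  refine HasDerivAt.fun_sum fun k _ => ?_
  have h1 : HasDerivAt (fun s : ℝ => (((k.1 : ℝ) * s + (k.2 : ℝ) * x.2 : ℝ) : ℂ))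
      ((k.1 : ℝ) : ℂ) x.1 := by
    simpa using (((hasDerivAt_id x.1).const_mul (k.1 : ℝ)).add_const ((k.2 : ℝ) * x.2)).ofReal_comp
  have h2 := ((h1.const_mul Complex.I).cexp).const_mul (c k)
  refine h2.congr_deriv ?_
  rw [char]
  ring

lemma dy (h : IsTrigSum N c φ) :
    IsTrigSum N (fun k => Complex.I * (k.2 : ℝ) * c k) (GalerkinNSE.dy φ) := by
  refine ⟨fun k hk => by simp [h.off k hk], fun x => of_hasDerivAt ?_⟩
  simp_rw [h.eq]
  refine HasDerivAt.fun_sum fun k _ => ?_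
  have h1 : HasDerivAt (fun s : ℝ => (((k.1 : ℝ) * x.1 + (k.2 : ℝ) * s : ℝ) : ℂ))
      ((k.2 : ℝ) : ℂ) x.2 := by
    simpa using (((hasDerivAt_id x.2).const_mul (k.2 : ℝ)).const_add ((k.1 : ℝ) * x.1)).ofReal_comp
  have h2 := ((h1.const_mul Complex.I).cexp).const_mul (c k)
  refine h2.congr_deriv ?_
  rw [char]
  ring

lemma lap (h : IsTrigSum N c φ) :
    IsTrigSum N (fun k => -(freqSq k : ℂ) * c k) (GalerkinNSE.lap φ) := by
  refine ⟨fun k hk => by simp [h.off k hk], fun x => ?_⟩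
  rw [GalerkinNSE.lap, Complex.ofReal_add, h.dx.dx.eq, h.dy.dy.eq, ← Finset.sum_add_distrib]
  refine Finset.sum_congr rfl fun k _ => ?_
  rw [freqSq]
  push_cast
  linear_combination (c k * char k x * ((k.1 : ℂ) ^ 2 + (k.2 : ℂ) ^ 2)) * Complex.I_sq

lemma l2norm_sq (h : IsTrigSum N c φ) : l2norm φ ^ 2 = 4 * Real.pi ^ 2 * mass (box N) c := by
  rw [l2norm, h.integral_sq, Real.sq_sqrt]
  exact mul_nonneg (by positivity) (mass_nonneg _ _)

lemma h1norm_sq (h : IsTrigSum N c φ) :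
    h1norm φ ^ 2 = 4 * Real.pi ^ 2 * enstrophy (box N) c := by
  have he : ∫ x in cell, (GalerkinNSE.dx φ x ^ 2 + GalerkinNSE.dy φ x ^ 2) =
      4 * Real.pi ^ 2 * enstrophy (box N) c := by
    have i1 : Integrable (fun x => GalerkinNSE.dx φ x ^ 2) (volume.restrict cell) :=
      (h.dx.continuous.pow 2).integrable_cell
    have i2 : Integrable (fun x => GalerkinNSE.dy φ x ^ 2) (volume.restrict cell) :=
      (h.dy.continuous.pow 2).integrable_cell
    rw [integral_add i1 i2, h.dx.integral_sq, h.dy.integral_sq, ← mul_add,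
      mass, mass, enstrophy, ← Finset.sum_add_distrib]
    congr 1
    refine Finset.sum_congr rfl fun k _ => ?_
    simp only [norm_mul, Complex.norm_I, Complex.norm_real, one_mul, mul_pow, Real.norm_eq_abs,
      sq_abs, freqSq]
    ring
  rw [h1norm, he, Real.sq_sqrt]
  exact mul_nonneg (by positivity) (enstrophy_nonneg _ _)

lemma continuous_advect (h : IsTrigSum N c φ) (h' : IsTrigSum N d χ) :
    Continuous (advect φ χ) :=
  (h.dy.continuous.neg.mul h'.dx.continuous).add (h.dx.continuous.mul h'.dy.continuous)

lemma fcoeff_advect (h : IsTrigSum N c φ) (h' : IsTrigSum N d χ) (m : ℤ × ℤ) :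
    fcoeff (advect φ χ) m =
      ∑ j ∈ box N, (((j.2 : ℝ) * m.1 - j.1 * m.2 : ℝ) : ℂ) * c j * d (m - j) := by
  have hsplit : fcoeff (advect φ χ) m =
      -fcoeff (fun x => GalerkinNSE.dy φ x * GalerkinNSE.dx χ x) m +
        fcoeff (fun x => GalerkinNSE.dx φ x * GalerkinNSE.dy χ x) m := by
    simp only [fcoeff]
    rw [← mul_neg, ← mul_add, ← integral_neg, ← integral_add]
    · congr 1
      refine integral_congr_ae (Filter.Eventually.of_forall fun x => ?_)
      simp only [advect]
      push_cast
      ring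
    · exact ((Complex.continuous_ofReal.comp (h.dy.continuous.mul h'.dx.continuous)).mul
        (continuous_char _)).neg.integrable_cell
    · exact ((Complex.continuous_ofReal.comp (h.dx.continuous.mul h'.dy.continuous)).mul
        (continuous_char _)).integrable_cell
  rw [hsplit, h.dy.fcoeff_mul h'.dx.continuous, h.dx.fcoeff_mul h'.dy.continuous, h'.dx.fcoeff_eq,
    h'.dy.fcoeff_eq, ← Finset.sum_neg_distrib, ← Finset.sum_add_distrib]
  refine Finset.sum_congr rfl fun j _ => ?_
  simp only [Prod.fst_sub, Prod.snd_sub]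
  push_cast
  -- The terms `j.1 * j.2` cancel, so `m - j` may be replaced by `m` in the cross product.
  linear_combination (c j * d (m - j) * (-(j.2 : ℂ) * (m.1 - j.1) + j.1 * (m.2 - j.2))) *
    Complex.I_sq

end IsTrigSum

/-! ### Projections, the Poincaré constant, and the scheme in coefficients. -/

lemma isTrigSum_fcoeff {N : ℕ} {φ : ℝ × ℝ → ℝ} (hφ : φ ∈ trigPoly N) :
    IsTrigSum N (fcoeff φ) φ := by
  obtain ⟨c, hc⟩ := exists_isTrigSum hφ
  rwa [hc.fcoeff_eq]

lemma IsProj.fcoeff_eq {N : ℕ} {g p : ℝ × ℝ → ℝ} (h : IsProj N g p) (hg : Continuous g)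
    {k : ℤ × ℤ} (hk : k ∈ box N) : fcoeff p k = fcoeff g k := by
  have hp := (isTrigSum_fcoeff h.1).continuous
  have hsub : fcoeff g k - fcoeff p k =
      ((4 * Real.pi ^ 2 : ℝ) : ℂ)⁻¹ * ∫ x in cell, ((g x - p x : ℝ) : ℂ) * char (-k) x := by
    rw [fcoeff, fcoeff, ← mul_sub, ← integral_sub]
    · simp_rw [← sub_mul, Complex.ofReal_sub]
    · exact ((Complex.continuous_ofReal.comp hg).mul (continuous_char _)).integrable_cell
    · exact ((Complex.continuous_ofReal.comp hp).mul (continuous_char _)).integrable_cell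
  have hk' := mem_box.1 (neg_mem_box hk)
  have h0 : (-k).1 ≠ 0 ∨ (-k).2 ≠ 0 := by
    by_contra! hc
    exact hk'.1 (Prod.ext hc.1 hc.2)
  have hcos := h.2 _ (Submodule.subset_span ⟨(-k).1, (-k).2, hk'.2.1, hk'.2.2, h0, Or.inl rfl⟩)
  have hsin := h.2 _ (Submodule.subset_span ⟨(-k).1, (-k).2, hk'.2.1, hk'.2.2, h0, Or.inr rfl⟩)
  have hint : ∫ x in cell, ((g x - p x : ℝ) : ℂ) * char (-k) x =
      ((∫ x in cell, (g x - p x) * Real.cos (((-k).1 : ℝ) * x.1 + ((-k).2 : ℝ) * x.2) : ℝ) : ℂ) +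
      ((∫ x in cell, (g x - p x) * Real.sin (((-k).1 : ℝ) * x.1 + ((-k).2 : ℝ) * x.2) : ℝ) : ℂ) *
        Complex.I := by
    rw [← integral_complex_ofReal, ← integral_complex_ofReal, ← integral_mul_const, ← integral_add]
    · refine integral_congr_ae (Filter.Eventually.of_forall fun x => ?_)
      simp only
      rw [char_eq]
      push_cast
      ring
    · exact Continuous.integrable_cell (by fun_prop)
    · exact Continuous.integrable_cell (by fun_prop)
  rw [hint, hcos, hsin] at hsub
  simp only [Complex.ofReal_zero, zero_mul, add_zero, mul_zero] at hsub
  exact (sub_eq_zero.1 hsub).symm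

lemma IsProj.integral_sq_le {N : ℕ} {g p : ℝ × ℝ → ℝ} (h : IsProj N g p)
    (hg : MemLp g 2 (volume.restrict cell)) :
    ∫ x in cell, p x ^ 2 ≤ ∫ x in cell, g x ^ 2 := by
  have hpc := (isTrigSum_fcoeff h.1).continuous
  have hp : MemLp p 2 (volume.restrict cell) :=
    (memLp_two_iff_integrable_sq hpc.aestronglyMeasurable).2 (hpc.pow 2).integrable_cell
  have hd := hg.sub hp
  have h1 : ∫ x in cell, g x ^ 2 = ∫ x in cell, ((g x - p x) ^ 2 + 2 * ((g x - p x) * p x) +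
      p x ^ 2) := by
    congr 1
    funext x
    ring
  have i1 : Integrable (fun x => (g x - p x) ^ 2) (volume.restrict cell) := hd.integrable_sq
  have i2 : Integrable (fun x => 2 * ((g x - p x) * p x)) (volume.restrict cell) :=
    (MemLp.integrable_mul hd hp).const_mul 2
  have i3 : Integrable (fun x => p x ^ 2) (volume.restrict cell) := hp.integrable_sq
  have i12 : Integrable (fun x => (g x - p x) ^ 2 + 2 * ((g x - p x) * p x))
      (volume.restrict cell) := i1.add i2
  rw [h1, integral_add i12 i3, integral_add i1 i2, integral_const_mul, h.2 p h.1]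
  have : 0 ≤ ∫ x in cell, (g x - p x) ^ 2 := integral_nonneg fun x => sq_nonneg _
  linarith

/-- The function `cos x` has equal `L²` and `H¹` norms. The estimates use the sharp constant 1,
through `|k| ≥ 1`; `c₀ ≥ 1` then weakens them to the stated form. -/
lemma one_le_of_isPoincareConst {c₀ : ℝ} (h : IsPoincareConst c₀) : 1 ≤ c₀ := by
  set φ : ℝ × ℝ → ℝ := fun x => Real.cos (((1 : ℤ) : ℝ) * x.1 + ((0 : ℤ) : ℝ) * x.2) with hφ
  have hmem : φ ∈ trigPoly 1 :=
    Submodule.subset_span ⟨1, 0, by norm_num, by norm_num, Or.inl one_ne_zero, Or.inl rfl⟩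
  have hle := h.2 1 φ hmem
  have hx : ∀ x, dx φ x = -Real.sin x.1 := by
    intro x
    have : (fun t : ℝ => φ (t, x.2)) = Real.cos := by
      funext t
      simp [hφ]
    rw [dx, this, Real.deriv_cos']
  have hy : ∀ x, dy φ x = 0 := by
    intro x
    have : (fun t : ℝ => φ (x.1, t)) = fun _ => Real.cos x.1 := by
      funext t
      simp [hφ]
    rw [dy, this, deriv_const]
  have hm : ∀ f : ℝ → ℝ, ∫ x in cell, f x.1 =
      2 * Real.pi * ∫ t in Set.Ioo 0 (2 * Real.pi), f t := by
    intro f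
    have := setIntegral_prod_mul (μ := (volume : Measure ℝ)) (ν := (volume : Measure ℝ)) f
      (fun _ : ℝ => (1 : ℝ)) (Set.Ioo 0 (2 * Real.pi)) (Set.Ioo 0 (2 * Real.pi))
    rw [← Measure.volume_eq_prod] at this
    simp only [mul_one] at this
    rw [cell, this]
    simp [Real.pi_pos.le, mul_comm]
  have hl2 : l2norm φ = √(2 * Real.pi * Real.pi) := by
    rw [l2norm]
    congr 1
    have : ∀ x : ℝ × ℝ, φ x ^ 2 = Real.cos x.1 ^ 2 := fun x => by simp [hφ]
    simp_rw [this]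
    rw [hm fun t => Real.cos t ^ 2, ← integral_Ioc_eq_integral_Ioo,
      ← intervalIntegral.integral_of_le (by positivity), integral_cos_sq]
    simp
  have hh1 : h1norm φ = √(2 * Real.pi * Real.pi) := by
    rw [h1norm]
    congr 1
    simp_rw [hx, hy]
    simp only [even_two, Even.neg_pow, ne_eq, OfNat.ofNat_ne_zero, not_false_eq_true, zero_pow,
      add_zero]
    rw [hm fun t => Real.sin t ^ 2, ← integral_Ioc_eq_integral_Ioo,
      ← intervalIntegral.integral_of_le (by positivity), integral_sin_sq]
    simp
  rw [hl2, hh1] at hle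
  have hpos : 0 < √(2 * Real.pi * Real.pi) := Real.sqrt_pos.2 (by positivity)
  by_contra! hc
  nlinarith

lemma IsGalerkinSolution.isStep {ν dt : ℝ} {N : ℕ} {ω₀ : ℝ × ℝ → ℝ} {f : ℕ → ℝ × ℝ → ℝ}
    {ω ψ : ℕ → ℝ × ℝ → ℝ} (h : IsGalerkinSolution ν dt N ω₀ f ω ψ) (hdt : 0 < dt) (n : ℕ) :
    ∃ g, IsProj N (f n) g ∧
      IsStep (box N) ν dt (fcoeff (ω n)) (fcoeff g) (fcoeff (ω (n + 1))) := by
  obtain ⟨q, g, hq, hg, heq⟩ := h.step n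
  have hv := isTrigSum_fcoeff (h.vorticity_mem n)
  have hw := isTrigSum_fcoeff (h.vorticity_mem (n + 1))
  have hψ := isTrigSum_fcoeff (h.stream_mem n)
  have hqs := isTrigSum_fcoeff hq.1
  have hgs := isTrigSum_fcoeff hg.1
  refine ⟨g, hg, fun k hk => (mem_box.1 hk).1, fun k hk => neg_mem_box hk, hv.off, hw.off,
    fcoeff_neg _, fcoeff_neg _, fun k hk => ?_⟩
  have hstream : ∀ j, (freqSq j : ℂ) * fcoeff (ψ n) j = fcoeff (ω n) j := by
    have : IsTrigSum N (fun j => (freqSq j : ℂ) * fcoeff (ψ n) j) (ω n) := by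
      refine ⟨fun j hj => by simp [hψ.off j hj], fun x => ?_⟩
      rw [← h.stream_eq n x, Complex.ofReal_neg, hψ.lap.eq, ← Finset.sum_neg_distrib]
      exact Finset.sum_congr rfl fun j _ => by ring
    intro j
    exact congrFun this.fcoeff_eq.symm j
  have hadv : fcoeff q k = advCoeff (box N) (fcoeff (ω n)) (fcoeff (ω n)) k := by
    rw [hq.fcoeff_eq (hψ.continuous_advect hv) hk, hψ.fcoeff_advect hv, advCoeff]
    refine Finset.sum_congr rfl fun j hj => ?_
    have hj0 : (freqSq j : ℂ) ≠ 0 := by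
      have := one_le_freqSq (mem_box.1 hj).1
      exact_mod_cast (by linarith : freqSq j ≠ 0)
    rw [← hstream j, Complex.ofReal_div]
    field_simp
  -- The pointwise equation says that this trigonometric sum is the zero function; uniqueness of
  -- coefficients then gives the modewise equation.
  have hzero : IsTrigSum N (fun k => (fcoeff (ω (n + 1)) k - fcoeff (ω n) k) / dt + fcoeff q k +
      ν * (freqSq k * fcoeff (ω (n + 1)) k) - fcoeff g k) 0 := by
    refine ⟨fun j hj => by simp [hv.off j hj, hw.off j hj, hqs.off j hj, hgs.off j hj],
      fun x => ?_⟩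
    have hx := congrArg (fun r : ℝ => (r : ℂ)) (sub_eq_zero.2 (heq x))
    simp only [Complex.ofReal_sub, Complex.ofReal_add, Complex.ofReal_div, Complex.ofReal_mul,
      hv.eq, hw.eq, hqs.eq, hgs.eq, hw.lap.eq, Complex.ofReal_zero, Finset.mul_sum,
      ← Finset.sum_sub_distrib, ← Finset.sum_add_distrib, Finset.sum_div] at hx
    rw [Pi.zero_apply, Complex.ofReal_zero, ← hx]
    exact Finset.sum_congr rfl fun j _ => by ring
  have h0 : fcoeff (0 : ℝ × ℝ → ℝ) k = 0 := by simp [fcoeff]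
  rw [hzero.fcoeff_eq] at h0
  simp only [hadv] at h0
  have hdt' : (dt : ℂ) ≠ 0 := by exact_mod_cast hdt.ne'
  field_simp at h0
  push_cast
  linear_combination h0

lemma l2norm_nonneg (φ : ℝ × ℝ → ℝ) : 0 ≤ l2norm φ := Real.sqrt_nonneg _

lemma IsProj.mass_fcoeff_le {N : ℕ} {g p : ℝ × ℝ → ℝ} (h : IsProj N g p) (hg : DotL2 g) {R : ℝ}
    (hR : l2norm g ≤ R) : mass (box N) (fcoeff p) ≤ (R / (2 * Real.pi)) ^ 2 := by
  have h1 := h.integral_sq_le hg.1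
  rw [(isTrigSum_fcoeff h.1).integral_sq] at h1
  have h2 : ∫ x in cell, g x ^ 2 = l2norm g ^ 2 :=
    (Real.sq_sqrt (integral_nonneg fun x => sq_nonneg (g x))).symm
  have h3 : l2norm g ^ 2 ≤ R ^ 2 := pow_le_pow_left₀ (l2norm_nonneg g) hR 2
  rw [div_pow, le_div_iff₀ (by positivity)]
  linarith

lemma IsGalerkinSolution.exists_orbit {ν dt F : ℝ} {N : ℕ} {ω₀ : ℝ × ℝ → ℝ}
    {f : ℕ → ℝ × ℝ → ℝ} {ω ψ : ℕ → ℝ × ℝ → ℝ} (h : IsGalerkinSolution ν dt N ω₀ f ω ψ)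
    (hdt : 0 < dt) (hf : ∀ n, DotL2 (f n) ∧ l2norm (f n) ≤ F) :
    ∃ g : ℕ → ℤ × ℤ → ℂ, (∀ n, mass (box N) (g n) ≤ (F / (2 * Real.pi)) ^ 2) ∧
      ∀ n, IsStep (box N) ν (√dt ^ 2) (fcoeff (ω n)) (g n) (fcoeff (ω (n + 1))) := by
  choose g hg hs using h.isStep hdt
  refine ⟨fun n => fcoeff (g n), fun n => (hg n).mass_fcoeff_le (hf n).1 (hf n).2, fun n => ?_⟩
  rw [Real.sq_sqrt hdt.le]
  exact hs n

/-! ### Choice of constants and the final assembly. -/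

/-- The uniform `L²` bound, enlarged so that `dt ≤ ν / (4 M₀²)` forces `dt ≤ ε`. -/
def l2Bound (c₀ ε a ν F : ℝ) : ℝ :=
  2 * Real.pi * massBound (a / (2 * Real.pi)) ν (F / (2 * Real.pi)) c₀ + √(ν / (4 * ε)) + 1

lemma massBound_nonneg (a ν F c₀ : ℝ) : 0 ≤ massBound a ν F c₀ := Real.sqrt_nonneg _

lemma l2Bound_pos (c₀ ε a ν F : ℝ) : 0 < l2Bound c₀ ε a ν F := by
  have := massBound_nonneg (a / (2 * Real.pi)) ν (F / (2 * Real.pi)) c₀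
  unfold l2Bound
  positivity

lemma le_of_le_div_l2Bound {c₀ ε a ν F dt : ℝ} (hε : 0 < ε)
    (h : dt ≤ ν / (4 * 1 ^ 2 * l2Bound c₀ ε a ν F ^ 2)) : dt ≤ ε := by
  refine h.trans ?_
  have hpos := l2Bound_pos c₀ ε a ν F
  have hs : √(ν / (4 * ε)) ≤ l2Bound c₀ ε a ν F := by
    have := massBound_nonneg (a / (2 * Real.pi)) ν (F / (2 * Real.pi)) c₀
    have : 0 ≤ 2 * Real.pi * massBound (a / (2 * Real.pi)) ν (F / (2 * Real.pi)) c₀ := by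
      positivity
    unfold l2Bound
    linarith
  have h2 := (Real.sqrt_le_left hpos.le).1 hs
  rw [div_le_iff₀ (by positivity)] at h2 ⊢
  linarith

end GalerkinNSE

end

theorem lemma3p3 :
    ∃ Cw : ℝ, 1 ≤ Cw ∧
    ∀ c₀ : ℝ, GalerkinNSE.IsPoincareConst c₀ →
    ∃ (M₀ : ℝ → ℝ → ℝ → ℝ) (M₁ : ℝ → ℝ → ℝ) (T : ℝ → ℝ → ℝ → ℝ),
      (∀ a ν F : ℝ, 0 < M₀ a ν F) ∧
      ∀ (ν F : ℝ), 0 < ν → 0 ≤ F →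
      ∀ (ω₀ : ℝ × ℝ → ℝ), GalerkinNSE.DotL2 ω₀ →
      ∀ (f : ℕ → ℝ × ℝ → ℝ),
        (∀ n, GalerkinNSE.DotL2 (f n) ∧ GalerkinNSE.l2norm (f n) ≤ F) →
      ∀ (N : ℕ) (dt : ℝ), 0 < dt →
      ∀ (ω ψ : ℕ → ℝ × ℝ → ℝ), GalerkinNSE.IsGalerkinSolution ν dt N ω₀ f ω ψ →
        (dt ≤ ν / (4 * Cw ^ 2 * M₀ (GalerkinNSE.l2norm ω₀) ν F ^ 2) →
          (∀ n : ℕ, GalerkinNSE.l2norm (ω n) ≤ M₀ (GalerkinNSE.l2norm ω₀) ν F) ∧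
          (∀ n : ℕ, GalerkinNSE.l2norm (ω n) ^ 2 ≤
            ((1 + ν / (2 * c₀ ^ 2) * dt) ^ n)⁻¹ * GalerkinNSE.l2norm ω₀ ^ 2 +
              2 * c₀ ^ 4 / ν ^ 2 * F ^ 2 * (1 - ((1 + ν / (2 * c₀ ^ 2) * dt) ^ n)⁻¹)) ∧
          (∀ i m : ℕ, 2 ≤ i → i ≤ m →
            ν / 2 * dt * ∑ n ∈ Finset.Icc i m, GalerkinNSE.h1norm (ω n) ^ 2 ≤
              GalerkinNSE.l2norm (ω (i - 1)) ^ 2 +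
                c₀ ^ 2 / ν * F ^ 2 * ((m : ℝ) - (i : ℝ) + 1) * dt)) ∧
        (dt ≤ min (ν / (4 * Cw ^ 2 * M₀ (GalerkinNSE.l2norm ω₀) ν F ^ 2)) (2 * c₀ ^ 2 / ν) →
          ∀ n : ℕ, T (GalerkinNSE.l2norm ω₀) ν F ≤ (n : ℝ) * dt →
            GalerkinNSE.h1norm (ω n) ≤ M₁ ν F) := by
  obtain ⟨Z, hZ1, hZ⟩ := GalerkinNSE.exists_sum_freqRt_le
  refine ⟨1, le_rfl, fun c₀ hPoincare => ?_⟩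
  have hc₀ := GalerkinNSE.one_le_of_isPoincareConst hPoincare
  have hZ0 : 0 ≤ Z := zero_le_one.trans hZ1
  -- The threshold must be a total function of `(a, ν, F)` for `M₀` to be defined; for `ν ≤ 0` it is
  -- the dummy value 1. The factors `2π` convert norms on the cell to coefficient norms.
  have hsmall : ∀ a ν F : ℝ, ∃ ε : ℝ, 0 < ε ∧ (0 < ν → ∀ dt, 0 < dt → dt ≤ ε →
      GalerkinNSE.IsSmallStep Z ν (F / (2 * Real.pi)) (a / (2 * Real.pi))
        (GalerkinNSE.massBound (a / (2 * Real.pi)) ν (F / (2 * Real.pi)) c₀) √dt) := by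
    intro a ν F
    by_cases hν : 0 < ν
    · obtain ⟨ε, hε, h⟩ := GalerkinNSE.exists_isSmallStep Z ν (F / (2 * Real.pi))
        (a / (2 * Real.pi))
        (GalerkinNSE.massBound (a / (2 * Real.pi)) ν (F / (2 * Real.pi)) c₀) hZ0 hν
      exact ⟨ε, hε, fun _ => h⟩
    · exact ⟨1, one_pos, fun h => absurd h hν⟩
  choose ε hε hsmall using hsmall
  refine ⟨fun a ν F => GalerkinNSE.l2Bound c₀ (ε a ν F) a ν F,
    fun ν F => √(4 * Real.pi ^ 2 * ((GalerkinNSE.windowBound ν (F / (2 * Real.pi)) c₀ +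
      2 * ((F / (2 * Real.pi)) ^ 2 / ν)) *
      Real.exp (Z / ν * GalerkinNSE.windowBound ν (F / (2 * Real.pi)) c₀))),
    fun a ν _ => 2 * c₀ ^ 2 * (a / (2 * Real.pi)) ^ 2 / ν + 5,
    fun a ν F => GalerkinNSE.l2Bound_pos _ _ _ _ _, ?_⟩
  intro ν F hν hF ω₀ hω₀ f hf N dt hdt ω ψ hsol
  obtain ⟨g, hg, hstep⟩ := hsol.exists_orbit hdt hf
  have hsq : √dt ^ 2 = dt := Real.sq_sqrt hdt.le
  have hF' : 0 ≤ F / (2 * Real.pi) := by positivity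
  have ha := hsol.init.mass_fcoeff_le hω₀ le_rfl
  have htrig : ∀ n, GalerkinNSE.IsTrigSum N (GalerkinNSE.fcoeff (ω n)) (ω n) := fun n =>
    GalerkinNSE.isTrigSum_fcoeff (hsol.vorticity_mem n)
  set a := GalerkinNSE.l2norm ω₀ with ha_def
  have hsm : dt ≤ ν / (4 * 1 ^ 2 * GalerkinNSE.l2Bound c₀ (ε a ν F) a ν F ^ 2) →
      GalerkinNSE.IsSmallStep Z ν (F / (2 * Real.pi)) (a / (2 * Real.pi))
        (GalerkinNSE.massBound (a / (2 * Real.pi)) ν (F / (2 * Real.pi)) c₀) √dt := fun h =>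
    hsmall a ν F hν dt hdt (GalerkinNSE.le_of_le_div_l2Bound (hε a ν F) h)
  refine ⟨fun hle => ⟨fun n => ?_, fun n => ?_, fun i m hi him => ?_⟩, fun hle n hn => ?_⟩
  · have h1 := GalerkinNSE.mass_orbit_le_massBound hstep (hsm hle) hν hF' hg (hZ N) hc₀ ha n
    have h0 := GalerkinNSE.massBound_nonneg (a / (2 * Real.pi)) ν (F / (2 * Real.pi)) c₀
    have h2 : GalerkinNSE.l2norm (ω n) ≤
        2 * Real.pi * GalerkinNSE.massBound (a / (2 * Real.pi)) ν (F / (2 * Real.pi)) c₀ := by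
      refine le_of_sq_le_sq ?_ (by positivity)
      rw [(htrig n).l2norm_sq, mul_pow, mul_pow]
      have : 0 ≤ 4 * Real.pi ^ 2 := by positivity
      nlinarith
    have h3 : 0 ≤ √(ν / (4 * ε a ν F)) := Real.sqrt_nonneg _
    simp only [GalerkinNSE.l2Bound]
    linarith
  · have h1 := GalerkinNSE.mass_orbit_le hstep (hsm hle) hν hF' hg (hZ N) hc₀ ha n
    rw [hsq] at h1
    rw [(htrig n).l2norm_sq]
    refine (mul_le_mul_of_nonneg_left h1 (by positivity)).trans (le_of_eq ?_)
    field_simp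
    ring
  -- The hypothesis `2 ≤ i` matches the shift in `sum_enstrophy_orbit_le`: the first iterate summed
  -- comes from a smoothed one.
  · obtain ⟨i, rfl⟩ : ∃ j, i = j + 2 := ⟨i - 2, by omega⟩
    have h1 := GalerkinNSE.sum_enstrophy_orbit_le hstep (hsm hle) hν hF' hg (hZ N) hc₀ ha i
      (m + 1 - (i + 2))
    rw [hsq] at h1
    rw [show Finset.Icc (i + 2) m = Finset.Ico (i + 2) (m + 1) from rfl,
      Finset.sum_Ico_eq_sum_range]
    simp_rw [(htrig _).h1norm_sq]
    rw [(htrig _).l2norm_sq, ← Finset.mul_sum, show i + 2 - 1 = i + 1 by omega]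
    have hcast : ((m + 1 - (i + 2) : ℕ) : ℝ) = (m : ℝ) - ((i + 2 : ℕ) : ℝ) + 1 := by
      rw [Nat.cast_sub (by omega)]
      push_cast
      ring
    rw [hcast] at h1
    have h2 := mul_le_mul_of_nonneg_left h1 (by positivity : 0 ≤ 4 * Real.pi ^ 2)
    have h3 : 4 * Real.pi ^ 2 * (((m : ℝ) - ((i + 2 : ℕ) : ℝ) + 1) * dt *
        ((F / (2 * Real.pi)) ^ 2 / ν)) ≤ c₀ ^ 2 / ν * F ^ 2 * ((m : ℝ) - ((i + 2 : ℕ) : ℝ) + 1) * dt := by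
      have hp : 0 ≤ (m : ℝ) - ((i + 2 : ℕ) : ℝ) + 1 := by rw [← hcast]; positivity
      calc _ = 1 * (F ^ 2 / ν * ((m : ℝ) - ((i + 2 : ℕ) : ℝ) + 1) * dt) := by
            field_simp
            ring
        _ ≤ c₀ ^ 2 * (F ^ 2 / ν * ((m : ℝ) - ((i + 2 : ℕ) : ℝ) + 1) * dt) := by
            refine mul_le_mul_of_nonneg_right (one_le_pow₀ hc₀) (by positivity)
        _ = _ := by ring
    linarith
  · have h1 := GalerkinNSE.enstrophy_orbit_le hstep (hsm (hle.trans (min_le_left _ _))) hν hF' hg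
      (hZ N) hZ0 hc₀ ha (n := n) (by rw [hsq]; exact hn)
    apply Real.le_sqrt_of_sq_le
    rw [(htrig n).h1norm_sq]
    exact mul_le_mul_of_nonneg_left h1 (by positivity)
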